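/- Let $r,q\ge 1$ be integers, let $\mathsf k$ be a field, and write $[q]=\{1,\dots,q\}$. **Extremal ideal.** Let $S_{\mathcal E}=\mathsf k[x_A : \emptyset\ne A\subseteq[q]]$, let $\epsilon_i=\prod_{A\subseteq[q],\, i\in A}x_A$ for $i\in[q]$, and let $\mathcal E_q=(\epsilon_1,\dots,\epsilon_q)\subseteq S_{\mathcal E}$. **The complex $\mathbb L^r_q$.** Let $\mathcal N^r_q=\{\mathbf a\in\mathbb Z_{\ge0}^q : a_1+\cdots+a_q=r\}$ and $s=\lceil r/2\rceil$. For $i\in[q]$ let $$F^r_i=\{\mathbf a\in\mathcal N^r_q : a_i\le\max\{r-1,s\}\text{ and }a_j\le s\text{ for all }j\ne i\},\qquad G^r_i=\{\mathbf a\in\mathcal N^r_q : a_i\ge r-1\}.$$ $\mathbb L^r_q$ is the simplicial complex with vertex set $\mathcal N^r_q$ whose faces are all the subsets of the sets $F^r_1,\dots,F^r_q,G^r_1,\dots,G^r_q$. Its dimension is the maximum of $|\sigma|-1$ over its faces $\sigma$. Label the vertex $\mathbf a$ with the monomial $\epsilon_1^{a_1}\cdots\epsilon_q^{a_q}$ and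 each face $\sigma$ with the least common multiple $M_\sigma$ of the labels of its vertices. **Supporting a minimal free resolution.** Fix a total order on the vertices. Let $\mathbb F_t$ be the free $S_{\mathcal E}$-module with basis $\{e_\sigma : \sigma\in\mathbb L^r_q,\ |\sigma|=t+1\}$, and let $$\partial(e_\sigma)=\sum_{j=0}^{t}(-1)^j\,\frac{M_\sigma}{M_{\sigma\smallsetminus\{v_j\}}}\,e_{\sigma\smallsetminus\{v_j\}}\qquad(\sigma=\{v_0<\cdots<v_t\},\ t\ge1),$$ with augmentation $\mathbb F_0\to S_{\mathcal E}$, $e_{\{v\}}\mapsto M_{\{v\}}$. The complex $\mathbb L^r_q$ *supports a free resolution* of $\mathcal E_q^r$ if $\cdots\to\mathbb F_1\to\mathbb F_0\to\mathcal E_q^r\to0$ is exact. This resolution is *minimal* if, for every $j$ and every free resolution $0\to S_{\mathcal E}^{\beta_t}\to\cdots\to S_{\mathcal E}^{\beta_0}\to\mathcal E_q^r\to0$, one has $\operatorname{rank}\mathbb F_j\le\beta_j$ (with $\beta_j=0$ for $j>t$). **Proposition.** The following statements are equivalent: 1. $\mathbb L^r_q$ supports a minimal free resolution of the ideal $\mathcal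 E_q^r$. 2. $\mathrm{pd}_{S_{\mathcal E}}(\mathcal E_q^r)=\dim\mathbb L^r_q$. 3. One of the following holds: $q=1$ and $r\ge1$; or $q=2$ and $1\le r\le4$; or $q\ge3$ and $1\le r\le2$. -/

import Mathlib

noncomputable section

/-! ### Free resolutions of an ideal -/

/-- `⋯ → F 1 → F 0 → I → 0` is exact: the augmentation `ε` is regarded as a map to the ring whose
image is `I`. -/
structure IsIdealResolution {S : Type*} [CommRing S] (I : Ideal S) (F : ℕ → Type*)
    [∀ n, AddCommGroup (F n)] [∀ n, Module S (F n)]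
    (d : ∀ n, F (n + 1) →ₗ[S] F n) (ε : F 0 →ₗ[S] S) : Prop where
  range_aug : LinearMap.range ε = I
  exact_aug : Function.Exact (d 0) ε
  exact_succ : ∀ n, Function.Exact (d (n + 1)) (d n)

/-- A resolution of `I` is minimal if in each spot its rank is at most that of the free module in
the same spot of any free resolution
`0 → S ^ β t → ⋯ → S ^ β 1 → S ^ β 0 → I → 0` of `I` of finite length. -/
def IsMinimalIdealResolution {S : Type*} [CommRing S] (I : Ideal S) (F : ℕ → Type*)
    [∀ n, AddCommGroup (F n)] [∀ n, Module S (F n)]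
    (d : ∀ n, F (n + 1) →ₗ[S] F n) (ε : F 0 →ₗ[S] S) : Prop :=
  IsIdealResolution I F d ε ∧
    ∀ (β : ℕ → ℕ) (d' : ∀ n, (Fin (β (n + 1)) → S) →ₗ[S] (Fin (β n) → S))
      (ε' : (Fin (β 0) → S) →ₗ[S] S),
      (∃ t, ∀ j, t < j → β j = 0) →
      IsIdealResolution I (fun n => Fin (β n) → S) d' ε' →
      ∀ j, Module.rank S (F j) ≤ (β j : Cardinal)

/-! ### The homogenized chain complex of a labelled simplicial complex -/

namespace PreAbstractSimplicialComplex

/-- The dimension of a simplicial complex: the supremum of `|σ| - 1` over its (nonempty) faces. -/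
def dimension {V : Type*} (Δ : PreAbstractSimplicialComplex V) : WithBot ℕ∞ :=
  ⨆ σ ∈ Δ.faces, ((σ.card - 1 : ℕ) : WithBot ℕ∞)

/-- The faces of dimension `n`, i.e. those with `n + 1` vertices. -/
abbrev FaceOfDim {V : Type*} (Δ : PreAbstractSimplicialComplex V) (n : ℕ) : Type _ :=
  {σ : Finset V // σ ∈ Δ.faces ∧ σ.card = n + 1}

variable {V τ : Type*} [LinearOrder V]

/-- The codimension one face `σ \ {v}`. -/
def FaceOfDim.erase {Δ : PreAbstractSimplicialComplex V} {n : ℕ} (σ : Δ.FaceOfDim (n + 1))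
    (v : {v // v ∈ σ.1}) : Δ.FaceOfDim n :=
  ⟨σ.1.erase v.1, by
    have hc : (σ.1.erase v.1).card = n + 1 := by
      rw [Finset.card_erase_of_mem v.2, σ.2.2]; rfl
    exact ⟨(Δ.isRelLowerSet_faces σ.2.1).2 (Finset.erase_subset _ _)
      (Finset.card_pos.1 (by omega)), hc⟩⟩

/-- The exponent vector of `M_σ`, the least common multiple of the labels of the vertices of `σ`;
the label of the vertex `v` is the monomial with exponent vector `label v`. -/
def faceLabel (label : V → τ →₀ ℕ) (σ : Finset V) : τ →₀ ℕ := σ.sup label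

/-- The free module with basis `e_σ`, `σ` ranging over the faces of dimension `n`. -/
abbrev Chain (k : Type*) [CommRing k] (τ : Type*) (Δ : PreAbstractSimplicialComplex V) (n : ℕ) :
    Type _ :=
  Δ.FaceOfDim n →₀ MvPolynomial τ k

/-- The homogenized boundary map
`∂ e_σ = ∑ v ∈ σ, (-1) ^ j * (M_σ / M_(σ \ {v})) • e_(σ \ {v})`, where `j` is the position of `v`
in `σ`, counted from zero. -/
def boundary (k : Type*) [CommRing k] (Δ : PreAbstractSimplicialComplex V)
    (label : V → τ →₀ ℕ) (n : ℕ) :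
    Chain k τ Δ (n + 1) →ₗ[MvPolynomial τ k] Chain k τ Δ n :=
  Finsupp.linearCombination (MvPolynomial τ k) fun σ : Δ.FaceOfDim (n + 1) =>
    ∑ v : {v // v ∈ σ.1}, Finsupp.single (σ.erase v)
      ((-1) ^ (σ.1.filter (· < v.1)).card *
        MvPolynomial.monomial (faceLabel label σ.1 - faceLabel label (σ.1.erase v.1)) 1)

/-- The augmentation sending the basis element of a vertex to the label of that vertex. -/
def augmentation (k : Type*) [CommRing k] (Δ : PreAbstractSimplicialComplex V)
    (label : V → τ →₀ ℕ) : Chain k τ Δ 0 →ₗ[MvPolynomial τ k] MvPolynomial τ k :=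
  Finsupp.linearCombination (MvPolynomial τ k) fun σ : Δ.FaceOfDim 0 =>
    MvPolynomial.monomial (faceLabel label σ.1) 1

/-- The labelled complex `Δ` supports a minimal free resolution of `I`: its homogenized chain
complex is a free resolution of `I`, and that resolution is minimal. -/
def SupportsMinimalFreeResolution {k : Type*} [CommRing k] (Δ : PreAbstractSimplicialComplex V)
    (label : V → τ →₀ ℕ) (I : Ideal (MvPolynomial τ k)) : Prop :=
  IsMinimalIdealResolution I (Chain k τ Δ) (Δ.boundary k label) (Δ.augmentation k label)

end PreAbstractSimplicialComplex

/-! ### The complex `𝕃^r_q` -/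

/-- The points of `ℕ ^ q` with coordinate sum `r`, ordered lexicographically (the order is only
used to fix the signs in the boundary maps). -/
abbrev LatticePoint (r q : ℕ) : Type :=
  {a : Lex (Fin q → ℕ) // ∑ i, ofLex a i = r}

/-- The sets `F^r_i` of the first layer; `(r + 1) / 2` is `⌈r / 2⌉`. -/
def firstLayer (r q : ℕ) (i : Fin q) : Set (LatticePoint r q) :=
  {a | ofLex a.1 i ≤ max (r - 1) ((r + 1) / 2) ∧ ∀ j, j ≠ i → ofLex a.1 j ≤ (r + 1) / 2}

/-- The sets `G^r_i` of the second layer. -/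
def secondLayer (r q : ℕ) (i : Fin q) : Set (LatticePoint r q) :=
  {a | r - 1 ≤ ofLex a.1 i}

/-- The simplicial complex `𝕃^r_q`. -/
def LComplex (r q : ℕ) : PreAbstractSimplicialComplex (LatticePoint r q) where
  faces := {σ | σ.Nonempty ∧
    ∃ i, (σ : Set (LatticePoint r q)) ⊆ firstLayer r q i ∨
      (σ : Set (LatticePoint r q)) ⊆ secondLayer r q i}
  isRelLowerSet_faces := by
    rintro σ ⟨hσ, i, hi⟩
    refine ⟨hσ, fun ρ hρ hne => ⟨hne, i, ?_⟩⟩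
    exact hi.imp (fun h => (Finset.coe_subset.2 hρ).trans h)
      (fun h => (Finset.coe_subset.2 hρ).trans h)

/-! ### Extremal ideals -/

/-- The index set of the variables `x_A`: the nonempty subsets `A` of `[q]`. -/
abbrev ExtremalVar (q : ℕ) : Type := {A : Finset (Fin q) // A.Nonempty}

/-- The ring `S_ℰ = k[x_A : ∅ ≠ A ⊆ [q]]`. -/
abbrev ExtremalRing (k : Type*) [CommRing k] (q : ℕ) : Type _ := MvPolynomial (ExtremalVar q) k

/-- The monomial `ε_i`, the product of all `x_A` with `i ∈ A`. -/
def extremalGenerator (k : Type*) [CommRing k] (q : ℕ) (i : Fin q) : ExtremalRing k q :=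
  ∏ A : ExtremalVar q with i ∈ A.1, MvPolynomial.X A

/-- The extremal ideal `ℰ_q = (ε_1, …, ε_q)`. -/
def extremalIdeal (k : Type*) [CommRing k] (q : ℕ) : Ideal (ExtremalRing k q) :=
  Ideal.span (Set.range (extremalGenerator k q))

/-- The exponent vector of `ε ^ a = ε_1 ^ a_1 ⋯ ε_q ^ a_q`, the label of the vertex `a`. -/
def extremalLabel (r q : ℕ) (a : LatticePoint r q) : ExtremalVar q →₀ ℕ :=
  ∑ i, ofLex a.1 i • ∑ A : ExtremalVar q with i ∈ A.1, Finsupp.single A 1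

/-- The label of the vertex `a` is indeed the monomial `ε ^ a`. -/
theorem monomial_extremalLabel (k : Type*) [CommRing k] (r q : ℕ) (a : LatticePoint r q) :
    MvPolynomial.monomial (extremalLabel r q a) (1 : k) =
      ∏ i, extremalGenerator k q i ^ ofLex a.1 i := by
  have h : ∀ i, extremalGenerator k q i = MvPolynomial.monomial
      (∑ A : ExtremalVar q with i ∈ A.1, Finsupp.single A 1) (1 : k) := by
    intro i
    rw [MvPolynomial.monomial_sum_one]
    rfl
  rw [extremalLabel, MvPolynomial.monomial_sum_one]
  simp only [h, MvPolynomial.monomial_pow, one_pow]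

end

noncomputable section
universe u

/-! ### Modules with finite free resolutions -/

/-! Write `s = ⌈r/2⌉`. Conditions 1 and 2 are each shown to be equivalent to 3.

Outside the list, `ℰ_q ^ r` has a finite free resolution with zero module in degree `n`, although
`𝕃^r_q` has a face of dimension `n` (`exists_face_of_not_small`). This contradicts minimality, and
also forces the projective dimension below `dim 𝕃^r_q`. Short resolutions come from Mayer–Vietoris:
if `I ∩ J` has length one less, then `I + J` is as short as `I` and `J`. For `q = 2` this gives
projective dimension at most one, while `F_0` contains a triangle once `r ≥ 5`. For `r, q ≥ 3`, let
`N` be the largest `|F_i|`. The Taylor resolution of the ideal of each `F_i` can be shortened by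
one, because one label divides the least common multiple of two others (`exists_dominated_triple`).
The ideals of the `F_i` are glued along the ideal of their common core (`exists_core_le`). The
remaining vertices are the corners `r e_i`, and adding one costs only a Taylor resolution on its `q
- 1 < N - 1` neighbours. Degree `N - 1` therefore stays empty, but `F_i` is a face with `N`
vertices.

In the listed cases, exactness is checked one multidegree `m` at a time: the faces whose vertex
labels divide `x^m` form an acyclic complex, because vertices can be removed one by one, each
dominated by another (`Dismantlable.acyclic`, `LComplex_dismantlable`). The boundary entries lie in
the ideal `𝔪` of polynomials without constant term, because each vertex of a face is alone in
attaining the largest exponent of some variable (`LComplex_exists_label_lt`). Comparison with any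
other resolution then bounds all ranks (`IsResolution.rank_le`), and the length equals the
projective dimension. -/

/-- `M` has a resolution by finite free modules concentrated in degrees less than `n`. -/
def FiniteFreeDimLT (S : Type u) [CommRing S] :
    ℕ → ∀ (M : Type u) [AddCommGroup M] [Module S M], Prop
  | 0, M, _, _ => Subsingleton M
  | n + 1, M, _, _ => ∃ (m : ℕ) (f : (Fin m → S) →ₗ[S] M),
      Function.Surjective f ∧ FiniteFreeDimLT S n (LinearMap.ker f)

namespace FiniteFreeDimLT

variable {S : Type u} [CommRing S] {A B C : Type u} [AddCommGroup A] [Module S A]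
  [AddCommGroup B] [Module S B] [AddCommGroup C] [Module S C]

theorem of_subsingleton [h : Subsingleton A] : FiniteFreeDimLT S 0 A := h

theorem of_equiv (e : A ≃ₗ[S] B) {n : ℕ} (h : FiniteFreeDimLT S n A) : FiniteFreeDimLT S n B := by
  cases n with
  | zero =>
    have : Subsingleton A := h
    exact e.symm.injective.subsingleton
  | succ n =>
    obtain ⟨m, f, hf, hk⟩ := h
    refine ⟨m, e.toLinearMap ∘ₗ f, e.surjective.comp hf, ?_⟩
    rwa [LinearMap.ker_comp_of_ker_eq_bot _ e.ker]

theorem mono_succ {n : ℕ} (h : FiniteFreeDimLT S n A) : FiniteFreeDimLT S (n + 1) A := by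
  induction n generalizing A with
  | zero =>
    have : Subsingleton A := h
    exact ⟨0, 0, Function.surjective_to_subsingleton _, (inferInstance : Subsingleton _)⟩
  | succ n ih =>
    obtain ⟨m, f, hf, hk⟩ := h
    exact ⟨m, f, hf, ih hk⟩

theorem mono {n n' : ℕ} (h : FiniteFreeDimLT S n A) (hn : n ≤ n') : FiniteFreeDimLT S n' A := by
  induction hn with
  | refl => exact h
  | step _ ih => exact ih.mono_succ

/-- A surjection from a finite free module whose kernel is resolved gives a resolution. -/
theorem of_surjective {ι : Type*} [Finite ι] {F : Type u} [AddCommGroup F] [Module S F]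
    (b : Module.Basis ι S F) {n : ℕ} (f : F →ₗ[S] A) (hf : Function.Surjective f)
    (h : FiniteFreeDimLT S n (LinearMap.ker f)) : FiniteFreeDimLT S (n + 1) A := by
  cases nonempty_fintype ι
  let e : F ≃ₗ[S] (Fin (Fintype.card ι) → S) := (b.reindex (Fintype.equivFin ι)).equivFun
  refine ⟨_, f ∘ₗ e.symm.toLinearMap, hf.comp e.symm.surjective, ?_⟩
  exact h.of_equiv (e.ofSubmodules _ _ (by
    ext x
    simp [LinearMap.ker_comp, Submodule.mem_map_equiv]))

/-- Extensions of modules with finite free resolutions. -/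
theorem extension {n : ℕ} {f : A →ₗ[S] B} {g : B →ₗ[S] C} (hf : Function.Injective f)
    (hfg : Function.Exact f g) (hg : Function.Surjective g)
    (hA : FiniteFreeDimLT S n A) (hC : FiniteFreeDimLT S n C) : FiniteFreeDimLT S n B := by
  induction n generalizing A B C with
  | zero =>
    have : Subsingleton A := hA
    have : Subsingleton C := hC
    refine ⟨fun x y => ?_⟩
    have key : ∀ z : B, z = 0 := fun z => by
      obtain ⟨a, rfl⟩ := (hfg z).1 (Subsingleton.elim _ _)
      rw [Subsingleton.elim a 0, map_zero]
    rw [key x, key y]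
  | succ n ih =>
    obtain ⟨a, α, hα, hαk⟩ := hA
    obtain ⟨c, γ, hγ, hγk⟩ := hC
    -- Horseshoe lemma: the free covers of `A` and `C` combine to a cover of `B`, and the three
    -- kernels again form a short exact sequence.
    obtain ⟨γ', hγ'⟩ := Module.projective_lifting_property g γ hg
    have hγ'' : ∀ z, g (γ' z) = γ z := fun z => LinearMap.congr_fun hγ' z
    have hgf : ∀ x, g (f x) = 0 := fun x => (hfg _).2 ⟨x, rfl⟩
    let φ : (Fin a → S) × (Fin c → S) →ₗ[S] B := (f ∘ₗ α).coprod γ'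
    refine of_surjective ((Pi.basisFun S (Fin a)).prod (Pi.basisFun S (Fin c))) φ ?_ ?_
    · intro b
      obtain ⟨z, hz⟩ := hγ (g b)
      obtain ⟨x, hx⟩ := (hfg (b - γ' z)).1 (by rw [map_sub, hγ'', hz, sub_self])
      obtain ⟨y, rfl⟩ := hα x
      exact ⟨(y, z), by simp [φ, hx]⟩
    · have hl : ∀ x : LinearMap.ker α,
          LinearMap.inl S (Fin a → S) (Fin c → S) x ∈ LinearMap.ker φ := fun x => by
        simp [φ]
      have hr : ∀ x : LinearMap.ker φ, x.1.2 ∈ LinearMap.ker γ := fun x => by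
        have h : f (α x.1.1) + γ' x.1.2 = 0 := x.2
        have := congrArg g h
        rwa [map_add, hgf, hγ'', zero_add, map_zero] at this
      refine ih (f := LinearMap.codRestrict _ (LinearMap.inl S (Fin a → S) (Fin c → S) ∘ₗ
          (LinearMap.ker α).subtype) hl)
        (g := LinearMap.codRestrict _ (LinearMap.snd S _ _ ∘ₗ (LinearMap.ker φ).subtype) hr)
        ?_ ?_ ?_ hαk hγk
      · intro x y h
        have := congrArg (fun z => z.1.1) h
        exact Subtype.ext this
      · rintro ⟨⟨x, y⟩, hx⟩
        constructor
        · intro h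
          have hy : y = 0 := congrArg Subtype.val h
          subst hy
          have hx' : f (α x) = 0 := by simpa [φ] using hx
          exact ⟨⟨x, hf (by simpa using hx')⟩, rfl⟩
        · rintro ⟨z, hz⟩
          rw [← hz]
          rfl
      · rintro ⟨z, hz⟩
        obtain ⟨x, hx⟩ := (hfg (γ' z)).1 (by rw [hγ'']; exact hz)
        obtain ⟨y, rfl⟩ := hα x
        exact ⟨⟨(-y, z), by simp [φ, hx]⟩, rfl⟩

/-- The cokernel of an injection between modules with finite free resolutions. -/
theorem quotient {n : ℕ} {f : A →ₗ[S] B} {g : B →ₗ[S] C} (hf : Function.Injective f)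
    (hfg : Function.Exact f g) (hg : Function.Surjective g)
    (hA : FiniteFreeDimLT S n A) (hB : FiniteFreeDimLT S (n + 1) B) :
    FiniteFreeDimLT S (n + 1) C := by
  obtain ⟨b, β, hβ, hk⟩ := hB
  refine ⟨b, g ∘ₗ β, hg.comp hβ, ?_⟩
  have hgf : ∀ x, g (f x) = 0 := fun x => (hfg _).2 ⟨x, rfl⟩
  let e := LinearEquiv.ofInjective f hf
  -- The new syzygy module `ker (g ∘ β)` is an extension of `range f ≅ A` by `ker β`.
  have hr : ∀ x : LinearMap.ker (g ∘ₗ β), β x ∈ LinearMap.range f := fun x => (hfg _).1 x.2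
  have hle : LinearMap.ker β ≤ LinearMap.ker (g ∘ₗ β) := LinearMap.ker_le_ker_comp _ _
  refine extension (f := Submodule.inclusion hle)
    (g := LinearMap.codRestrict (LinearMap.range f) (β ∘ₗ Submodule.subtype _) hr)
    (Submodule.inclusion_injective hle) ?_ ?_ hk (hA.of_equiv e)
  · rintro ⟨x, hx⟩
    constructor
    · intro h
      exact ⟨⟨x, congrArg Subtype.val h⟩, rfl⟩
    · rintro ⟨z, hz⟩
      rw [← hz]
      exact Subtype.ext z.2
  · rintro ⟨_, x, rfl⟩
    obtain ⟨y, hy⟩ := hβ (f x)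
    exact ⟨⟨y, by simp [hy, hgf]⟩, Subtype.ext hy⟩

theorem prod {n : ℕ} (hA : FiniteFreeDimLT S n A) (hB : FiniteFreeDimLT S n B) :
    FiniteFreeDimLT S n (A × B) :=
  extension (f := LinearMap.inl S A B) (g := LinearMap.snd S A B) LinearMap.inl_injective
    (Function.Exact.inl_snd (R := S) (M := A) (N := B)) LinearMap.snd_surjective hA hB

/-- The Mayer–Vietoris argument for the sum of two ideals. -/
theorem sup {n : ℕ} {I J : Ideal S} (h : FiniteFreeDimLT S n ↥(I ⊓ J))
    (hI : FiniteFreeDimLT S (n + 1) I) (hJ : FiniteFreeDimLT S (n + 1) J) :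
    FiniteFreeDimLT S (n + 1) ↥(I ⊔ J) := by
  let g₀ : I × J →ₗ[S] S := I.subtype.coprod J.subtype
  have hg : ∀ x, g₀ x ∈ I ⊔ J := fun x => by
    simpa [g₀] using Submodule.add_mem_sup x.1.2 x.2.2
  refine quotient (f := (Submodule.inclusion inf_le_left).prod (-Submodule.inclusion inf_le_right))
    (g := LinearMap.codRestrict _ g₀ hg) ?_ ?_ ?_ h (hI.prod hJ)
  · intro x y h
    exact Subtype.ext (congrArg (fun z : I × J => (z.1 : S)) h)
  · rintro ⟨⟨x, hx⟩, ⟨y, hy⟩⟩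
    constructor
    · intro h
      have h' : x + y = 0 := congrArg Subtype.val h
      obtain rfl : y = -x := (neg_eq_of_add_eq_zero_right h').symm
      exact ⟨⟨x, hx, by simpa using hy⟩, rfl⟩
    · rintro ⟨z, hz⟩
      rw [← hz]
      exact Subtype.ext (by simp [g₀])
  · rintro ⟨z, hz⟩
    obtain ⟨x, hx, y, hy, rfl⟩ := Submodule.mem_sup.1 hz
    exact ⟨(⟨x, hx⟩, ⟨y, hy⟩), rfl⟩

theorem span_singleton [IsDomain S] {x : S} (hx : x ≠ 0) :
    FiniteFreeDimLT S 1 (Ideal.span {x} : Ideal S) := by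
  let e := LinearEquiv.toSpanNonzeroSingleton S S x hx
  refine of_surjective (Module.Basis.singleton Unit S) e.toLinearMap e.surjective ?_
  change Subsingleton _
  rw [e.ker]
  infer_instance

open CategoryTheory in
theorem hasProjectiveDimensionLT {n : ℕ} (h : FiniteFreeDimLT S n A) :
    HasProjectiveDimensionLT (ModuleCat.of S A) n := by
  induction n generalizing A with
  | zero =>
    have : Subsingleton A := h
    exact (ModuleCat.isZero_of_subsingleton (ModuleCat.of S A)).hasProjectiveDimensionLT_zero
  | succ n ih =>
    obtain ⟨m, f, hf, hk⟩ := h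
    have hS : (ModuleCat.ofHom (LinearMap.ker f).subtype) ≫ ModuleCat.ofHom f = 0 := by
      ext x; simp
    have hse : (ShortComplex.mk _ _ hS).ShortExact :=
      { exact := by
          rw [ShortComplex.ShortExact.moduleCat_exact_iff_function_exact]
          exact LinearMap.exact_subtype_ker_map f
        mono_f := (ModuleCat.mono_iff_injective _).2 Subtype.val_injective
        epi_g := (ModuleCat.epi_iff_surjective _).2 hf }
    have : Projective (ModuleCat.of S (Fin m → S)) :=
      ModuleCat.projective_of_free (Pi.basisFun S (Fin m))
    exact hse.hasProjectiveDimensionLT_X₃ n (ih hk)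
      (hasProjectiveDimensionLT_of_ge _ 1 _ (by omega))

/-- Unwinding of `FiniteFreeDimLT` to an infinite sequence of modules and maps. -/
theorem exists_resolution {n : ℕ} (h : FiniteFreeDimLT S n A) :
    ∃ (β : ℕ → ℕ) (d : ∀ n, (Fin (β (n + 1)) → S) →ₗ[S] (Fin (β n) → S))
      (ε : (Fin (β 0) → S) →ₗ[S] A), (∀ j, n ≤ j → β j = 0) ∧ Function.Surjective ε ∧
      Function.Exact (d 0) ε ∧ ∀ n, Function.Exact (d (n + 1)) (d n) := by
  induction n generalizing A with
  | zero =>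
    have : Subsingleton A := h
    exact ⟨fun _ => 0, fun _ => 0, 0, fun _ _ => rfl, Function.surjective_to_subsingleton _,
      fun x => ⟨fun _ => ⟨0, Subsingleton.elim _ _⟩, fun _ => rfl⟩,
      fun _ x => ⟨fun _ => ⟨0, Subsingleton.elim _ _⟩, fun _ => rfl⟩⟩
  | succ n ih =>
    obtain ⟨m, f, hf, hk⟩ := h
    obtain ⟨β, d, ε, hβ, hε, h0, hs⟩ := ih hk
    let β' : ℕ → ℕ := fun i => Nat.casesOn i m β
    let d' : ∀ i, (Fin (β' (i + 1)) → S) →ₗ[S] (Fin (β' i) → S) := fun i =>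
      match i with
      | 0 => (LinearMap.ker f).subtype ∘ₗ ε
      | i + 1 => d i
    refine ⟨β', d', f, ?_, hf, ?_, ?_⟩
    · rintro (_ | j) hj
      · omega
      · exact hβ j (by omega)
    · intro x
      constructor
      · intro hx
        obtain ⟨y, hy⟩ := hε ⟨x, hx⟩
        exact ⟨y, congrArg Subtype.val hy⟩
      · rintro ⟨y, rfl⟩
        exact (ε y).2
    · rintro (_ | i)
      · intro x
        rw [← h0 x]
        exact ⟨fun h => Subtype.ext h, fun h => congrArg Subtype.val h⟩
      · exact hs i

theorem exists_isIdealResolution {n : ℕ} {I : Ideal S} (h : FiniteFreeDimLT S n I) :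
    ∃ (β : ℕ → ℕ) (d : ∀ n, (Fin (β (n + 1)) → S) →ₗ[S] (Fin (β n) → S))
      (ε : (Fin (β 0) → S) →ₗ[S] S), (∀ j, n ≤ j → β j = 0) ∧
      IsIdealResolution I (fun n => Fin (β n) → S) d ε := by
  obtain ⟨β, d, ε, hβ, hε, h0, hs⟩ := h.exists_resolution
  refine ⟨β, d, I.subtype ∘ₗ ε, hβ, ?_, ?_, hs⟩
  · rw [LinearMap.range_comp, LinearMap.range_eq_top.2 hε, Submodule.map_top,
      Submodule.range_subtype]
  · intro x
    rw [← h0 x]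
    exact ⟨fun h => Subtype.ext h, fun h => congrArg Subtype.val h⟩

attribute [irreducible] FiniteFreeDimLT

end FiniteFreeDimLT
end

noncomputable section
universe u

/-! ### Monomial ideals given by labels -/

section LabelIdeal

variable {k : Type u} [Field k] {τ : Type} {V W : Type*}

/-- The ideal generated by the monomials with exponent vectors `label v`, `v ∈ P`. -/
def labelIdeal (k : Type u) [Field k] (label : V → τ →₀ ℕ) (P : Set V) :
    Ideal (MvPolynomial τ k) :=
  Ideal.span ((fun s => MvPolynomial.monomial s (1 : k)) '' (label '' P))

theorem mem_labelIdeal {label : V → τ →₀ ℕ} {P : Set V} {x : MvPolynomial τ k} :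
    x ∈ labelIdeal k label P ↔ ∀ m ∈ x.support, ∃ v ∈ P, label v ≤ m := by
  rw [labelIdeal, MvPolynomial.mem_ideal_span_monomial_image]
  simp

theorem labelIdeal_union (label : V → τ →₀ ℕ) (P Q : Set V) :
    labelIdeal k label (P ∪ Q) = labelIdeal k label P ⊔ labelIdeal k label Q := by
  simp only [labelIdeal, Set.image_union, Ideal.span_union]

/-- A monomial lies in both ideals exactly when it is a multiple of some `lcm (label v, label w)`.
The hypotheses say that the labels of `R` generate the same ideal as these least common multiples.
-/
theorem labelIdeal_inf {label : V → τ →₀ ℕ} {label' : W → τ →₀ ℕ} {P Q : Set V} {R : Set W}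
    (h : ∀ v ∈ P, ∀ w ∈ Q, ∃ c ∈ R, label' c ≤ label v ⊔ label w)
    (hP : ∀ c ∈ R, ∃ v ∈ P, label v ≤ label' c) (hQ : ∀ c ∈ R, ∃ v ∈ Q, label v ≤ label' c) :
    labelIdeal k label P ⊓ labelIdeal k label Q = labelIdeal k label' R := by
  ext x
  simp only [Submodule.mem_inf, mem_labelIdeal, ← forall₂_and]
  refine forall₂_congr fun m _ => ⟨?_, ?_⟩
  · rintro ⟨⟨v, hv, hvm⟩, w, hw, hwm⟩
    obtain ⟨c, hc, hcm⟩ := h v hv w hw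
    exact ⟨c, hc, hcm.trans (sup_le hvm hwm)⟩
  · rintro ⟨c, hc, hcm⟩
    obtain ⟨v, hv, hvc⟩ := hP c hc
    obtain ⟨w, hw, hwc⟩ := hQ c hc
    exact ⟨⟨v, hv, hvc.trans hcm⟩, w, hw, hwc.trans hcm⟩

theorem finiteFreeDimLT_labelIdeal_union {label : V → τ →₀ ℕ} {label' : W → τ →₀ ℕ}
    {P Q : Set V} {R : Set W} {n : ℕ}
    (h : ∀ v ∈ P, ∀ w ∈ Q, ∃ c ∈ R, label' c ≤ label v ⊔ label w)
    (hP : ∀ c ∈ R, ∃ v ∈ P, label v ≤ label' c) (hQ : ∀ c ∈ R, ∃ v ∈ Q, label v ≤ label' c)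
    (hR' : FiniteFreeDimLT (MvPolynomial τ k) n (labelIdeal k label' R))
    (hP' : FiniteFreeDimLT (MvPolynomial τ k) (n + 1) (labelIdeal k label P))
    (hQ' : FiniteFreeDimLT (MvPolynomial τ k) (n + 1) (labelIdeal k label Q)) :
    FiniteFreeDimLT (MvPolynomial τ k) (n + 1) (labelIdeal k label (P ∪ Q)) := by
  rw [labelIdeal_union]
  refine FiniteFreeDimLT.sup ?_ hP' hQ'
  rwa [labelIdeal_inf h hP hQ]

theorem finiteFreeDimLT_labelIdeal_singleton (label : V → τ →₀ ℕ) (a : V) :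
    FiniteFreeDimLT (MvPolynomial τ k) 1 (labelIdeal k label {a}) := by
  rw [labelIdeal, Set.image_singleton, Set.image_singleton]
  exact FiniteFreeDimLT.span_singleton (by simp)

theorem finiteFreeDimLT_labelIdeal_empty (label : V → τ →₀ ℕ) :
    FiniteFreeDimLT (MvPolynomial τ k) 0 (labelIdeal k label ∅) := by
  rw [labelIdeal, Set.image_empty, Set.image_empty, Ideal.span_empty]
  exact FiniteFreeDimLT.of_subsingleton

/-- Adding one generator `a`; the intersection ideal is generated by the least common multiples of
the labels of `a` and of the elements of `R`. -/
theorem finiteFreeDimLT_labelIdeal_insert {label : V → τ →₀ ℕ} {P R : Set V} {a : V} {n : ℕ}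
    (hRP : R ⊆ P) (h : ∀ v ∈ P, ∃ c ∈ R, label c ≤ label v ⊔ label a)
    (hR : FiniteFreeDimLT (MvPolynomial τ k) n (labelIdeal k (fun v => label v ⊔ label a) R))
    (hP : FiniteFreeDimLT (MvPolynomial τ k) (n + 1) (labelIdeal k label P)) :
    FiniteFreeDimLT (MvPolynomial τ k) (n + 1) (labelIdeal k label (insert a P)) := by
  rw [Set.insert_eq, Set.union_comm]
  refine finiteFreeDimLT_labelIdeal_union ?_ ?_ ?_ hR hP
    ((finiteFreeDimLT_labelIdeal_singleton label a).mono (by omega))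
  · rintro v hv w rfl
    obtain ⟨c, hc, hcv⟩ := h v hv
    exact ⟨c, hc, sup_le hcv le_sup_right⟩
  · exact fun c hc => ⟨c, hRP hc, le_sup_left⟩
  · exact fun c _ => ⟨a, rfl, le_sup_right⟩

/-- The length of the Taylor resolution. -/
theorem finiteFreeDimLT_labelIdeal_card (label : V → τ →₀ ℕ) (P : Finset V) :
    FiniteFreeDimLT (MvPolynomial τ k) P.card (labelIdeal k label P) := by
  classical
  induction P using Finset.induction_on generalizing label with
  | empty =>
    rw [Finset.coe_empty]
    exact finiteFreeDimLT_labelIdeal_empty label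
  | insert a P ha ih =>
    rw [Finset.card_insert_of_notMem ha, Finset.coe_insert]
    -- The intersection with the ideal of `a` is generated by `P` relabelled with `lcm (label v,
    -- label a)`, so the induction must run over all labels.
    exact finiteFreeDimLT_labelIdeal_insert subset_rfl (fun v hv => ⟨v, hv, le_sup_left⟩)
      (ih _) (ih _).mono_succ

/-- The Taylor resolution is not the shortest one if one generator divides the least common
multiple of two others. -/
theorem finiteFreeDimLT_labelIdeal_card_sub_one (label : V → τ →₀ ℕ) {P : Finset V} {a b c : V}
    (ha : a ∈ P) (hb : b ∈ P) (hc : c ∈ P) (hab : a ≠ b) (hac : a ≠ c) (hbc : b ≠ c)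
    (h : label c ≤ label a ⊔ label b) :
    FiniteFreeDimLT (MvPolynomial τ k) (P.card - 1) (labelIdeal k label P) := by
  classical
  have hb' : b ∈ P.erase a := Finset.mem_erase.2 ⟨hab.symm, hb⟩
  have h1 : ((P.erase a).erase b).card + 1 = (P.erase a).card := Finset.card_erase_add_one hb'
  have h2 : (P.erase a).card + 1 = P.card := Finset.card_erase_add_one ha
  -- Split off `a`. As `lcm (c, a)` divides `lcm (b, a)`, the generator coming from `b` is redundant
  -- in the intersection, which leaves `P.card - 2` generators.
  have key := finiteFreeDimLT_labelIdeal_insert (k := k) (label := label)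
    (R := ((P.erase a).erase b : Finset V)) (P := (P.erase a : Finset V)) (a := a)
    (n := ((P.erase a).erase b).card) (Finset.coe_subset.2 (Finset.erase_subset _ _)) ?_
    (finiteFreeDimLT_labelIdeal_card _ _)
    (by rw [h1]; exact finiteFreeDimLT_labelIdeal_card _ _)
  · rw [← Finset.coe_insert, Finset.insert_erase ha] at key
    exact key.mono (by omega)
  · intro v hv
    by_cases hvb : v = b
    · subst hvb
      refine ⟨c, ?_, h.trans_eq (sup_comm _ _)⟩
      simp [hc, hbc.symm, hac.symm]
    · exact ⟨v, by simpa [hvb] using hv, le_sup_left⟩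

end LabelIdeal

/-! ### Lattice points -/

namespace LatticePoint

variable {r q : ℕ}

instance : Finite (LatticePoint r q) := by
  refine Finite.of_injective
    (fun (a : LatticePoint r q) (i : Fin q) =>
      (⟨ofLex a.1 i, Nat.lt_succ_of_le ?_⟩ : Fin (r + 1))) ?_
  · exact (Finset.single_le_sum (f := ofLex a.1) (fun _ _ => Nat.zero_le _)
      (Finset.mem_univ i)).trans_eq a.2
  · intro a b h
    refine Subtype.ext (ofLex.injective (funext fun i => ?_))
    simpa using congrFun h i

theorem ext_coord {a b : LatticePoint r q} (h : ∀ i, ofLex a.1 i = ofLex b.1 i) : a = b :=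
  Subtype.ext (ofLex.injective (funext h))

theorem sum_le (a : LatticePoint r q) (A : Finset (Fin q)) : ∑ i ∈ A, ofLex a.1 i ≤ r :=
  (Finset.sum_le_sum_of_subset (Finset.subset_univ A)).trans_eq a.2

theorem coord_le (a : LatticePoint r q) (i : Fin q) : ofLex a.1 i ≤ r :=
  (Finset.sum_singleton (ofLex a.1) i).symm.trans_le (a.sum_le {i})

theorem coord_add_le (a : LatticePoint r q) {i j : Fin q} (hij : i ≠ j) :
    ofLex a.1 i + ofLex a.1 j ≤ r :=
  (Finset.sum_pair (f := ofLex a.1) hij).symm.trans_le (a.sum_le {i, j})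

theorem coord_le_sum (a : LatticePoint r q) {A : Finset (Fin q)} {i : Fin q} (hi : i ∈ A) :
    ofLex a.1 i ≤ ∑ j ∈ A, ofLex a.1 j :=
  Finset.single_le_sum (f := fun j => ofLex a.1 j) (fun _ _ => Nat.zero_le _) hi

/-- The vertex `r e_i`. -/
def corner (r : ℕ) {q : ℕ} (i : Fin q) : LatticePoint r q :=
  ⟨toLex (Pi.single i r), by simp⟩

theorem corner_coord (i j : Fin q) : ofLex (corner r i).1 j = if j = i then r else 0 := by
  simp [corner, Pi.single_apply]

theorem eq_corner {a : LatticePoint r q} {i : Fin q} (h : r ≤ ofLex a.1 i) : a = corner r i := by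
  refine ext_coord fun j => ?_
  rw [corner_coord]
  split_ifs with hj
  · subst hj
    exact le_antisymm (a.coord_le j) h
  · have := a.coord_add_le hj
    omega

/-- The two corrections stand on opposite sides so that no truncated subtraction of sums occurs. -/
theorem sum_move_aux (f : Fin q → ℕ) {i j : Fin q} (hij : i ≠ j) {t : ℕ} (ht : t ≤ f i)
    (A : Finset (Fin q)) :
    ∑ l ∈ A, (if l = i then f i - t else if l = j then f j + t else f l) +
      (if i ∈ A then t else 0) = ∑ l ∈ A, f l + (if j ∈ A then t else 0) := by
  have e : ∀ l, (if l = i then f i - t else if l = j then f j + t else f l) +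
      (if l = i then t else 0) = f l + (if l = j then t else 0) := by
    intro l
    by_cases h1 : l = i
    · subst h1
      simp [hij]; omega
    · by_cases h2 : l = j
      · subst h2; simp [h1]
      · simp [h1, h2]
  have := Finset.sum_congr rfl fun l (_ : l ∈ A) => e l
  simpa [Finset.sum_add_distrib] using this

/-- The vertex `a - t e_i + t e_j`. -/
def move (a : LatticePoint r q) {i j : Fin q} (hij : i ≠ j) (t : ℕ) (ht : t ≤ ofLex a.1 i) :
    LatticePoint r q :=
  ⟨toLex fun l => if l = i then ofLex a.1 i - t else if l = j then ofLex a.1 j + t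
    else ofLex a.1 l, by
    have := sum_move_aux (ofLex a.1) hij ht Finset.univ
    rw [a.2] at this
    simpa using this⟩

section move

variable (a : LatticePoint r q) {i j : Fin q} (hij : i ≠ j) (t : ℕ) (ht : t ≤ ofLex a.1 i)

theorem move_coord (l : Fin q) : ofLex (a.move hij t ht).1 l =
    if l = i then ofLex a.1 i - t else if l = j then ofLex a.1 j + t else ofLex a.1 l := rfl

theorem sum_move (A : Finset (Fin q)) :
    ∑ l ∈ A, ofLex (a.move hij t ht).1 l + (if i ∈ A then t else 0) =
      ∑ l ∈ A, ofLex a.1 l + (if j ∈ A then t else 0) :=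
  sum_move_aux (ofLex a.1) hij ht A

end move

end LatticePoint

theorem extremalLabel_apply {r q : ℕ} (a : LatticePoint r q) (A : ExtremalVar q) :
    extremalLabel r q a A = ∑ i ∈ A.1, ofLex a.1 i := by
  classical
  simp only [extremalLabel, Finsupp.coe_finsetSum, Finset.sum_apply, Finsupp.smul_apply,
    smul_eq_mul]
  have : ∀ i : Fin q, (∑ B : ExtremalVar q with i ∈ B.1, Finsupp.single B 1 A : ℕ) =
      if i ∈ A.1 then 1 else 0 := by
    intro i
    simp [Finsupp.single_apply, Finset.sum_ite_eq', Finset.mem_filter]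
  simp only [this, mul_ite, mul_one, mul_zero]
  rw [Finset.sum_ite_mem, Finset.univ_inter]

/-- Divisibility becomes a family of linear inequalities between subset sums. The empty subset,
which has no variable, contributes nothing. -/
theorem extremalLabel_le_sup {r q : ℕ} {a b c : LatticePoint r q} :
    extremalLabel r q c ≤ extremalLabel r q a ⊔ extremalLabel r q b ↔
      ∀ A : Finset (Fin q), ∑ i ∈ A, ofLex c.1 i ≤
        max (∑ i ∈ A, ofLex a.1 i) (∑ i ∈ A, ofLex b.1 i) := by
  simp only [Finsupp.le_def, Finsupp.sup_apply, extremalLabel_apply]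
  constructor
  · intro h A
    obtain rfl | hA := A.eq_empty_or_nonempty
    · exact Nat.zero_le _
    · exact h ⟨A, hA⟩
  · exact fun h A => h A.1

/-- `ℰ_q ^ r` is generated by the labels of all the vertices. -/
theorem extremalIdeal_pow (k : Type u) [Field k] (r q : ℕ) :
    extremalIdeal k q ^ r = labelIdeal k (extremalLabel r q) Set.univ := by
  have : labelIdeal k (extremalLabel r q) Set.univ = Ideal.span (Set.range
      fun a : LatticePoint r q => ∏ i, extremalGenerator k q i ^ ofLex a.1 i) := by
    rw [labelIdeal, Set.image_univ, ← Set.range_comp]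
    congr 2
    ext1 a
    exact monomial_extremalLabel k r q a
  rw [this]
  clear this
  generalize hg : extremalGenerator k q = g
  rw [extremalIdeal, hg]
  apply le_antisymm
  · induction r with
    | zero =>
      rw [pow_zero, Ideal.one_eq_top, top_le_iff, Ideal.eq_top_iff_one]
      exact Ideal.subset_span ⟨⟨toLex 0, Finset.sum_const_zero⟩,
        Finset.prod_eq_one fun i _ => pow_zero _⟩
    | succ r ih =>
      rw [pow_succ]
      refine (Ideal.mul_mono_left ih).trans ?_
      rw [Ideal.span_mul_span', Ideal.span_le]
      rintro _ ⟨_, ⟨a, rfl⟩, _, ⟨i, rfl⟩, rfl⟩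
      refine Ideal.subset_span ⟨⟨toLex (ofLex a.1 + Pi.single i 1), ?_⟩, ?_⟩
      · exact (Finset.sum_add_distrib (f := ofLex a.1)).trans (congrArg₂ (· + ·) a.2 (by simp))
      · simp only [ofLex_toLex, Pi.add_apply, pow_add, Finset.prod_mul_distrib]
        congr 1
        rw [Finset.prod_eq_single i] <;> simp +contextual
  · rw [Ideal.span_le]
    rintro _ ⟨a, rfl⟩
    have := Ideal.prod_mem_prod (ι := Fin q) (s := Finset.univ)
      (I := fun i => Ideal.span (Set.range g) ^ ofLex a.1 i) (x := fun i => g i ^ ofLex a.1 i)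
      fun i _ => Ideal.pow_mem_pow (Ideal.subset_span (Set.mem_range_self i)) _
    rwa [Finset.prod_pow_eq_pow_sum, a.2] at this
end

noncomputable section
universe u

/-! ### Short resolutions of `ℰ_q ^ r` -/

namespace LatticePoint

variable {r q : ℕ}

/-- The common part of the sets `F^r_i`. -/
def core (r q : ℕ) : Set (LatticePoint r q) := {a | ∀ j, ofLex a.1 j ≤ (r + 1) / 2}

theorem core_subset_firstLayer (i : Fin q) : core r q ⊆ firstLayer r q i :=
  fun _ ha => ⟨(ha i).trans (le_max_right _ _), fun j _ => ha j⟩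

/-- Take `c = (r - s - 1) e_i + s e_j + e_l`, `a = c - e_l + e_i` and `b = c - e_j + e_l`. If the
sum of `c` over `A` exceeds that of `a`, then `l ∈ A`, and passing from `c` to `b` cannot lower the
sum over such an `A`. The entry `b_l = 2` stays in the core because `r ≥ 3`. -/
theorem exists_dominated_triple (hr : 3 ≤ r) (hq : 3 ≤ q) :
    ∃ a ∈ core r q, ∃ b ∈ core r q, ∃ c ∈ core r q, a ≠ b ∧ a ≠ c ∧ b ≠ c ∧
      extremalLabel r q c ≤ extremalLabel r q a ⊔ extremalLabel r q b := by
  obtain ⟨i, j, l, hij, hil, hjl⟩ : ∃ i j l : Fin q, i ≠ j ∧ i ≠ l ∧ j ≠ l :=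
    ⟨⟨0, by omega⟩, ⟨1, by omega⟩, ⟨2, by omega⟩, by simp, by simp, by simp⟩
  have h0 : (r + 1) / 2 ≤ ofLex (corner r i).1 i := by
    rw [corner_coord, if_pos rfl]; omega
  have h1 : 1 ≤ ofLex ((corner r i).move hij _ h0).1 i := by
    rw [move_coord, if_pos rfl, corner_coord, if_pos rfl]; omega
  generalize hc : ((corner r i).move hij _ h0).move hil 1 h1 = c
  have hcc : ∀ m, ofLex c.1 m = if m = i then r - (r + 1) / 2 - 1 else
      if m = j then (r + 1) / 2 else if m = l then 1 else 0 := by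
    intro m
    rw [← hc]
    simp only [move_coord, corner_coord, if_true]
    split_ifs <;> simp_all
  have hci := hcc i
  have hcj := hcc j
  have hcl := hcc l
  simp only [if_true, if_neg hij.symm, if_neg hil.symm, if_neg hjl.symm] at hci hcj hcl
  have h2 : 1 ≤ ofLex c.1 l := hcl.ge
  have h3 : 1 ≤ ofLex c.1 j := by omega
  have ha := move_coord c hil.symm 1 h2
  have hb := move_coord c hjl 1 h3
  have hal := ha l
  have hbl := hb l
  simp only [if_true, if_neg hjl.symm] at hal hbl
  refine ⟨c.move hil.symm 1 h2, ?_, c.move hjl 1 h3, ?_, c, ?_, ?_, ?_, ?_, ?_⟩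
  · intro m
    rw [ha, hcc m]
    split_ifs <;> omega
  · intro m
    rw [hb, hcc m]
    split_ifs <;> omega
  · intro m
    rw [hcc m]
    split_ifs <;> omega
  · intro h
    rw [h] at hal
    omega
  · intro h
    rw [h] at hal
    omega
  · intro h
    rw [h] at hbl
    omega
  · rw [extremalLabel_le_sup]
    intro A
    have s1 := sum_move c hil.symm 1 h2 A
    have s2 := sum_move c hjl 1 h3 A
    split_ifs at s1 s2 <;> omega

/-- If neither `a ∈ F_i` nor `b ∈ F_j` lies in the core, then part of the `i`-th coordinate of `a`
can be moved to the `j`-th one. -/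
theorem exists_core_le {i j : Fin q} (hij : i ≠ j) {a b : LatticePoint r q}
    (ha : a ∈ firstLayer r q i) (hb : b ∈ firstLayer r q j) :
    ∃ c ∈ core r q, extremalLabel r q c ≤ extremalLabel r q a ⊔ extremalLabel r q b := by
  by_cases hai : ofLex a.1 i ≤ (r + 1) / 2
  · refine ⟨a, fun l => ?_, le_sup_left⟩
    obtain rfl | hl := eq_or_ne l i
    exacts [hai, ha.2 l hl]
  by_cases hbj : ofLex b.1 j ≤ (r + 1) / 2
  · refine ⟨b, fun l => ?_, le_sup_right⟩
    obtain rfl | hl := eq_or_ne l j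
    exacts [hbj, hb.2 l hl]
  -- Exactly the excess `a_i - s` is moved, so the new `j`-th coordinate is at most `r - s ≤ s`.
  have haij := a.coord_add_le hij
  refine ⟨a.move hij (ofLex a.1 i - (r + 1) / 2) (Nat.sub_le _ _), fun l => ?_, ?_⟩
  · rw [move_coord]
    split_ifs with h1 h2
    · omega
    · omega
    · exact ha.2 l h1
  · rw [extremalLabel_le_sup]
    intro A
    have hs := sum_move a hij (ofLex a.1 i - (r + 1) / 2) (Nat.sub_le _ _) A
    by_cases hiA : i ∈ A
    · rw [if_pos hiA] at hs
      split_ifs at hs <;> omega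
    · rw [if_neg hiA] at hs
      split_ifs at hs with hjA
      -- The only sums that grow have `j ∈ A` and `i ∉ A`; the new sum is then at most `r - s ≤ s <
      -- b_j`.
      · have h1 := a.sum_le (insert i A)
        rw [Finset.sum_insert hiA] at h1
        have h2 := b.coord_le_sum hjA
        omega
      · omega

/-- Any other vertex forces a neighbour of the corner `r e_i` to divide the least common
multiple. -/
theorem exists_move_corner_le (hr : 1 ≤ r) {i : Fin q} {a : LatticePoint r q}
    (ha : a ≠ corner r i) : ∃ (j : Fin q) (hij : i ≠ j) (h : 1 ≤ ofLex (corner r i).1 i),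
      extremalLabel r q ((corner r i).move hij 1 h) ≤
        extremalLabel r q a ⊔ extremalLabel r q (corner r i) := by
  have h1 : 1 ≤ ofLex (corner r i).1 i := by rwa [corner_coord, if_pos rfl]
  -- Any `j ≠ i` in the support of `a` works: the neighbour exceeds the corner only on sets with `j
  -- ∈ A`, `i ∉ A`, where its sum is `1 ≤ a_j`.
  obtain ⟨j, hij, hj⟩ : ∃ j, i ≠ j ∧ 1 ≤ ofLex a.1 j := by
    by_contra! h
    refine ha (ext_coord fun j => ?_)
    rw [corner_coord]
    split_ifs with hj
    · subst hj
      exact (Finset.sum_eq_single_of_mem (f := ofLex a.1) j (Finset.mem_univ _) fun l _ hl => by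
        have := h l hl.symm; omega).symm.trans a.2
    · have := h j (Ne.symm hj); omega
  refine ⟨j, hij, h1, ?_⟩
  rw [extremalLabel_le_sup]
  intro A
  have hs := sum_move (corner r i) hij 1 h1 A
  by_cases hjA : j ∈ A
  · have h2 := a.coord_le_sum hjA
    by_cases hiA : i ∈ A
    · rw [if_pos hiA] at hs
      split_ifs at hs; omega
    · have h3 : ∑ l ∈ A, ofLex (corner r i).1 l = 0 := Finset.sum_eq_zero fun l hl => by
        rw [corner_coord, if_neg]; rintro rfl; exact hiA hl
      split_ifs at hs; omega
  · rw [if_neg hjA] at hs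
    omega

end LatticePoint

open LatticePoint

theorem finiteFreeDimLT_sub_one_core (k : Type u) [Field k] {r q : ℕ} (hr : 3 ≤ r) (hq : 3 ≤ q)
    {P : Set (LatticePoint r q)} (hP : core r q ⊆ P) :
    FiniteFreeDimLT (ExtremalRing k q) (P.ncard - 1) (labelIdeal k (extremalLabel r q) P) := by
  obtain ⟨a, ha, b, hb, c, hc, hab, hac, hbc, h⟩ := exists_dominated_triple hr hq
  have hfin := P.toFinite
  have := finiteFreeDimLT_labelIdeal_card_sub_one (k := k) (extremalLabel r q)
    (P := hfin.toFinset) (hfin.mem_toFinset.2 (hP ha)) (hfin.mem_toFinset.2 (hP hb))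
    (hfin.mem_toFinset.2 (hP hc)) hab hac hbc h
  rwa [hfin.coe_toFinset, ← Set.ncard_eq_toFinset_card P hfin] at this

/-- The points `(r - t) e_i + t e_j` with `t ∈ {1, 2}` and `j ≠ i` already number `2 (q - 1) > q`.
This leaves room for the `q - 1` neighbours met when a corner is added. -/
theorem card_firstLayer_gt {r q : ℕ} (hr : 3 ≤ r) (hq : 3 ≤ q) (i : Fin q) :
    q < (firstLayer r q i).ncard := by
  classical
  have h0 : ∀ t : Bool, (if t then 1 else 2) ≤ ofLex (corner r i).1 i := by
    intro t
    rw [corner_coord, if_pos rfl]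
    split_ifs <;> omega
  let f : {j : Fin q // i ≠ j} × Bool → LatticePoint r q := fun x =>
    (corner r i).move x.1.2 _ (h0 x.2)
  have hf : ∀ x l, ofLex (f x).1 l = if l = i then r - (if x.2 then 1 else 2) else
      if l = x.1.1 then (if x.2 then 1 else 2) else 0 := by
    intro x l
    simp only [f, move_coord, corner_coord, if_true, if_neg x.1.2.symm, zero_add]
    split_ifs <;> rfl
  have hinj : Function.Injective f := by
    rintro ⟨⟨j, hj⟩, s⟩ ⟨⟨l, hl⟩, t⟩ h
    have h1 := hf ⟨⟨j, hj⟩, s⟩ j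
    rw [h, hf] at h1
    simp only [if_neg hj.symm, if_true] at h1
    by_cases hjl : j = l
    · subst hjl
      rw [if_pos rfl] at h1
      cases s <;> cases t <;> simp_all
    · rw [if_neg hjl] at h1
      split_ifs at h1
  have hcard : 2 * (q - 1) ≤ (firstLayer r q i).ncard := by
    have h1 : (Set.range f).ncard = Nat.card ({j : Fin q // i ≠ j} × Bool) := by
      rw [← Set.image_univ, Set.ncard_image_of_injective _ hinj, Set.ncard_univ]
    have h2 : Nat.card ({j : Fin q // i ≠ j} × Bool) = 2 * (q - 1) := by
      simp only [Nat.card_eq_fintype_card, Fintype.card_prod, Fintype.card_bool, ne_eq,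
        Fintype.card_subtype_compl, Fintype.card_fin, Fintype.card_subtype_eq', mul_comm]
    rw [← h2, ← h1]
    refine Set.ncard_le_ncard ?_ (Set.toFinite _)
    rintro _ ⟨x, rfl⟩
    refine ⟨?_, fun j hj => ?_⟩
    · rw [hf, if_pos rfl]
      split_ifs <;> omega
    · rw [hf, if_neg hj]
      split_ifs <;> omega
  omega

/-- The point `(r - 1) e_i + e_j` lies in `F_i`, but not in the core, because `r - 1 > s` once `r ≥
4`. The gain of one is what Mayer–Vietoris requires of the intersection. -/
theorem card_core_lt {r q : ℕ} (hr : 4 ≤ r) (hq : 3 ≤ q) (i : Fin q) :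
    (core r q).ncard < (firstLayer r q i).ncard := by
  obtain ⟨j, hij⟩ : ∃ j, i ≠ j := by
    have : Nontrivial (Fin q) := Fin.nontrivial_iff_two_le.2 (by omega)
    obtain ⟨j, hj⟩ := exists_ne i
    exact ⟨j, hj.symm⟩
  refine Set.ncard_lt_ncard ⟨core_subset_firstLayer i, fun h => ?_⟩ (Set.toFinite _)
  have h1 : 1 ≤ ofLex (corner r i).1 i := by rw [corner_coord, if_pos rfl]; omega
  have hm : (corner r i).move hij 1 h1 ∈ firstLayer r q i := by
    refine ⟨?_, fun l hl => ?_⟩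
    · rw [move_coord, if_pos rfl, corner_coord, if_pos rfl]; omega
    · rw [move_coord, if_neg hl, corner_coord, corner_coord, if_neg hij.symm, if_neg hl]
      split_ifs <;> omega
  have := h hm i
  rw [move_coord, if_pos rfl, corner_coord, if_pos rfl] at this
  omega

theorem finiteFreeDimLT_firstLayer (k : Type u) [Field k] {r q : ℕ} (hr : 3 ≤ r)
    (hq : 3 ≤ q) {i₀ : Fin q} {n : ℕ} (hn : (firstLayer r q i₀).ncard = n + 2)
    (hi₀ : ∀ i, (firstLayer r q i).ncard ≤ (firstLayer r q i₀).ncard) :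
    FiniteFreeDimLT (ExtremalRing k q) (n + 1)
      (labelIdeal k (extremalLabel r q) (⋃ i, firstLayer r q i)) := by
  classical
  have hF : ∀ i, FiniteFreeDimLT (ExtremalRing k q) (n + 1)
      (labelIdeal k (extremalLabel r q) (firstLayer r q i)) := fun i =>
    (finiteFreeDimLT_sub_one_core k hr hq (core_subset_firstLayer i)).mono
      (by have := hi₀ i; omega)
  -- For `r = 3` one has `r - 1 = s`, so all `F_i` equal the core and no gluing is needed.
  obtain hr3 | hr4 := hr.eq_or_lt
  · have : (⋃ i, firstLayer r q i) = firstLayer r q i₀ := by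
      refine (Set.iUnion_subset fun i => ?_).antisymm (Set.subset_iUnion _ i₀)
      intro a ha
      refine core_subset_firstLayer i₀ fun j => ?_
      obtain rfl | hj := eq_or_ne j i
      exacts [ha.1.trans (by omega), ha.2 j hj]
    rw [this]
    exact hF i₀
  · have key : ∀ T : Finset (Fin q), FiniteFreeDimLT (ExtremalRing k q) (n + 1)
        (labelIdeal k (extremalLabel r q) (⋃ i ∈ T, firstLayer r q i)) := by
      intro T
      induction T using Finset.induction_on with
      | empty =>
        have : (⋃ i ∈ (∅ : Finset (Fin q)), firstLayer r q i) = ∅ := by simp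
        rw [this]
        exact (finiteFreeDimLT_labelIdeal_empty _).mono (Nat.zero_le _)
      | insert i T hi ih =>
        obtain rfl | ⟨j, hj⟩ := T.eq_empty_or_nonempty
        · have : (⋃ j ∈ insert i (∅ : Finset (Fin q)), firstLayer r q j) = firstLayer r q i := by
            simp
          rw [this]
          exact hF i
        rw [Finset.set_biUnion_insert, Set.union_comm]
        refine finiteFreeDimLT_labelIdeal_union (R := core r q) ?_
          (fun c hc => ⟨c, Set.mem_biUnion hj (core_subset_firstLayer j hc), le_rfl⟩)
          (fun c hc => ⟨c, core_subset_firstLayer i hc, le_rfl⟩) ?_ ih (hF i)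
        · intro v hv w hw
          obtain ⟨l, hl, hv⟩ := Set.mem_iUnion₂.1 hv
          have hli : l ≠ i := by
            rintro rfl
            exact hi hl
          exact exists_core_le hli hv hw
        · exact (finiteFreeDimLT_sub_one_core k hr hq subset_rfl).mono
            (by have := card_core_lt hr4 hq i₀; omega)
    have htop : (⋃ i, firstLayer r q i) =
        ⋃ i ∈ (Finset.univ : Finset (Fin q)), firstLayer r q i := by simp
    rw [htop]
    exact key Finset.univ

/-- At most one coordinate exceeds `s`, since two would add up to more than `r`; so the `F_i` miss
only the corners. -/
theorem mem_iUnion_firstLayer {r q : ℕ} (hr : 3 ≤ r) (hq : 1 ≤ q) {a : LatticePoint r q} :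
    a ∈ ⋃ i, firstLayer r q i ↔ ∀ i, ofLex a.1 i < r := by
  rw [Set.mem_iUnion]
  refine ⟨?_, fun ha => ?_⟩
  · rintro ⟨i, hi⟩ j
    obtain rfl | hj := eq_or_ne j i
    · have := hi.1; omega
    · have := hi.2 j hj; omega
  · by_cases h : ∃ i, (r + 1) / 2 < ofLex a.1 i
    · obtain ⟨i, hi⟩ := h
      refine ⟨i, ?_, fun j hj => ?_⟩
      · have := ha i; omega
      · have := a.coord_add_le hj
        omega
    · push Not at h
      exact ⟨⟨0, hq⟩, core_subset_firstLayer _ h⟩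

/-- Adding a corner `r e_i` to a set which contains its neighbours. -/
theorem finiteFreeDimLT_insert_corner (k : Type u) [Field k] {r q n : ℕ} (hr : 1 ≤ r)
    (hqn : q ≤ n + 1) {i : Fin q} {P : Set (LatticePoint r q)} (hi : corner r i ∉ P)
    (hmem : ∀ (j : Fin q) (hij : i ≠ j) (h : 1 ≤ ofLex (corner r i).1 i),
      (corner r i).move hij 1 h ∈ P)
    (hP : FiniteFreeDimLT (ExtremalRing k q) (n + 1) (labelIdeal k (extremalLabel r q) P)) :
    FiniteFreeDimLT (ExtremalRing k q) (n + 1)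
      (labelIdeal k (extremalLabel r q) (insert (corner r i) P)) := by
  classical
  have h1 : 1 ≤ ofLex (corner r i).1 i := by rw [corner_coord, if_pos rfl]; omega
  let R : Finset (LatticePoint r q) :=
    Finset.univ.image fun j : {j : Fin q // i ≠ j} => (corner r i).move j.2 1 h1
  have hR : R.card ≤ n := by
    refine Finset.card_image_le.trans ?_
    simp only [Finset.card_univ, ne_eq, Fintype.card_subtype_compl, Fintype.card_fin,
      Fintype.card_subtype_eq']
    omega
  refine finiteFreeDimLT_labelIdeal_insert (R := (R : Set (LatticePoint r q))) ?_ ?_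
    ((finiteFreeDimLT_labelIdeal_card _ R).mono hR) hP
  · intro c hc
    obtain ⟨⟨j, hij⟩, -, rfl⟩ := Finset.mem_image.1 hc
    exact hmem j hij h1
  · intro v hv
    have hvi : v ≠ corner r i := by
      rintro rfl
      exact hi hv
    obtain ⟨j, hij, _, hj⟩ := exists_move_corner_le hr hvi
    exact ⟨_, Finset.mem_coe.2 (Finset.mem_image.2 ⟨⟨j, hij⟩, Finset.mem_univ _, rfl⟩), hj⟩

/-- For `r, q ≥ 3` the resolution of `ℰ_q ^ r` is shorter than the dimension of a largest simplex
`F_i`. -/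
theorem exists_finiteFreeDimLT_extremalIdeal_pow (k : Type u) [Field k] {r q : ℕ} (hr : 3 ≤ r)
    (hq : 3 ≤ q) : ∃ i, 2 ≤ (firstLayer r q i).ncard ∧
      FiniteFreeDimLT (ExtremalRing k q) ((firstLayer r q i).ncard - 1)
      ↥(extremalIdeal k q ^ r) := by
  classical
  have : Nonempty (Fin q) := ⟨⟨0, by omega⟩⟩
  obtain ⟨i₀, hi₀⟩ := Finite.exists_max fun i => (firstLayer r q i).ncard
  have hN := card_firstLayer_gt hr hq i₀
  refine ⟨i₀, by omega, ?_⟩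
  obtain ⟨n, hn⟩ : ∃ n, (firstLayer r q i₀).ncard = n + 2 :=
    ⟨_, (Nat.sub_add_cancel (by omega)).symm⟩
  have hcorner : ∀ T : Finset (Fin q), FiniteFreeDimLT (ExtremalRing k q) (n + 1)
      (labelIdeal k (extremalLabel r q) ((⋃ i, firstLayer r q i) ∪ corner r '' T)) := by
    intro T
    induction T using Finset.induction_on with
    | empty =>
      rw [Finset.coe_empty, Set.image_empty, Set.union_empty]
      exact finiteFreeDimLT_firstLayer k hr hq hn hi₀
    | insert i T hi ih =>
      rw [Finset.coe_insert, Set.image_insert_eq, Set.union_insert]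
      refine finiteFreeDimLT_insert_corner k (by omega) (by omega) ?_ ?_ ih
      · have hcc := corner_coord (r := r) i i
        rw [if_pos rfl] at hcc
        rintro (hv | ⟨j, hj, hji⟩)
        · have := (mem_iUnion_firstLayer hr (by omega)).1 hv i
          omega
        · rw [← hji, corner_coord] at hcc
          split_ifs at hcc with h
          · exact hi (h ▸ hj)
          · omega
      · intro j hij h1
        refine Or.inl ((mem_iUnion_firstLayer hr (by omega)).2 fun l => ?_)
        rw [move_coord, corner_coord, corner_coord, corner_coord, if_pos rfl, if_neg hij.symm]
        split_ifs <;> omega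
  have htop : (⋃ i, firstLayer r q i) ∪ corner r '' (Finset.univ : Finset (Fin q)) = Set.univ := by
    refine Set.eq_univ_of_forall fun a => ?_
    by_cases h : ∃ i, r ≤ ofLex a.1 i
    · obtain ⟨i, hi⟩ := h
      exact Or.inr ⟨i, by simp, (eq_corner hi).symm⟩
    · push Not at h
      exact Or.inl ((mem_iUnion_firstLayer hr (by omega)).2 h)
  rw [hn, extremalIdeal_pow, ← htop]
  exact hcorner _

end

/-! ### Two generators, and the failure of conditions 1 and 2 outside the list. -/

noncomputable section
universe u

open LatticePoint

theorem LatticePoint.eq_of_coord_zero_eq {r : ℕ} {a b : LatticePoint r 2}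
    (h : ofLex a.1 0 = ofLex b.1 0) : a = b := by
  have ha : ofLex a.1 0 + ofLex a.1 1 = r := by
    have := a.2; rwa [Fin.sum_univ_two] at this
  have hb : ofLex b.1 0 + ofLex b.1 1 = r := by
    have := b.2; rwa [Fin.sum_univ_two] at this
  refine ext_coord fun i => ?_
  fin_cases i
  · exact h
  · change ofLex a.1 1 = ofLex b.1 1
    omega

theorem LatticePoint.exists_coord_eq {r t : ℕ} (ht : t ≤ r) :
    ∃ a : LatticePoint r 2, ofLex a.1 0 = t ∧ ofLex a.1 1 = r - t :=
  ⟨⟨toLex ![t, r - t], by rw [Fin.sum_univ_two]; exact Nat.add_sub_of_le ht⟩, rfl, rfl⟩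

/-- With two coordinates of constant sum, `b` bounds the first coordinate of `c` and `a` bounds the
second. -/
theorem LatticePoint.label_le_sup_of_between {r : ℕ} {a b c : LatticePoint r 2}
    (h1 : ofLex a.1 0 ≤ ofLex c.1 0) (h2 : ofLex c.1 0 ≤ ofLex b.1 0) :
    extremalLabel r 2 c ≤ extremalLabel r 2 a ⊔ extremalLabel r 2 b := by
  have ha := a.2
  have hb := b.2
  have hc := c.2
  rw [Fin.sum_univ_two] at ha hb hc
  rw [extremalLabel_le_sup]
  intro A
  by_cases hA0 : (0 : Fin 2) ∈ A <;> by_cases hA1 : (1 : Fin 2) ∈ A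
  · have : A = Finset.univ := by ext i; fin_cases i <;> simpa
    subst this
    rw [Fin.sum_univ_two, Fin.sum_univ_two, Fin.sum_univ_two]; omega
  · have : A = {0} := by ext i; fin_cases i <;> simpa
    subst this
    rw [Finset.sum_singleton, Finset.sum_singleton, Finset.sum_singleton]; omega
  · have : A = {1} := by ext i; fin_cases i <;> simpa
    subst this
    rw [Finset.sum_singleton, Finset.sum_singleton, Finset.sum_singleton]; omega
  · have : A = ∅ := by ext i; fin_cases i <;> simpa
    subst this
    rw [Finset.sum_empty]; exact Nat.zero_le _

/-- Add the vertices by increasing first coordinate. The previous vertex lies between the new one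
and all earlier ones, so each intersection is principal. -/
theorem finiteFreeDimLT_extremalIdeal_two_pow (k : Type u) [Field k] (r : ℕ) :
    FiniteFreeDimLT (ExtremalRing k 2) 2 ↥(extremalIdeal k 2 ^ r) := by
  have key : ∀ t, FiniteFreeDimLT (ExtremalRing k 2) 2
      (labelIdeal k (extremalLabel r 2) {a | ofLex a.1 0 ≤ t}) := by
    intro t
    induction t with
    | zero =>
      obtain ⟨p, hp, -⟩ := exists_coord_eq (Nat.zero_le r)
      have : {a : LatticePoint r 2 | ofLex a.1 0 ≤ 0} = {p} := by
        ext a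
        exact ⟨fun h => eq_of_coord_zero_eq ((Nat.le_zero.1 h).trans hp.symm),
          by rintro rfl; exact hp.le⟩
      rw [this]
      exact (finiteFreeDimLT_labelIdeal_singleton _ p).mono_succ
    | succ t ih =>
      by_cases ht : t + 1 ≤ r
      · obtain ⟨p, hp, -⟩ := exists_coord_eq ht
        obtain ⟨p', hp', -⟩ := exists_coord_eq (Nat.le_of_succ_le ht)
        have : {a : LatticePoint r 2 | ofLex a.1 0 ≤ t + 1} =
            insert p {a : LatticePoint r 2 | ofLex a.1 0 ≤ t} := by
          ext a
          constructor
          · intro (h : ofLex a.1 0 ≤ t + 1)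
            obtain h | h := Nat.le_or_eq_of_le_succ h
            · exact Or.inr h
            · exact Or.inl (eq_of_coord_zero_eq (h.trans hp.symm))
          · rintro (rfl | h)
            · exact hp.le
            · exact Nat.le_succ_of_le h
        rw [this]
        refine finiteFreeDimLT_labelIdeal_insert (n := 1)
          (P := {a : LatticePoint r 2 | ofLex a.1 0 ≤ t}) (R := {p'}) ?_ ?_
          (finiteFreeDimLT_labelIdeal_singleton _ p') ih
        · rintro _ rfl
          exact hp'.le
        · intro v hv
          exact ⟨p', rfl, label_le_sup_of_between (le_of_le_of_eq hv hp'.symm) (by omega)⟩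
      · have : {a : LatticePoint r 2 | ofLex a.1 0 ≤ t + 1} =
          {a : LatticePoint r 2 | ofLex a.1 0 ≤ t} := by
          ext a
          have := a.coord_le 0
          simp only [Set.mem_ofPred_eq]
          omega
        rw [this]
        exact ih
  have htop : {a : LatticePoint r 2 | ofLex a.1 0 ≤ r} = Set.univ :=
    Set.eq_univ_of_forall fun a => a.coord_le 0
  rw [extremalIdeal_pow, ← htop]
  exact key r

namespace PreAbstractSimplicialComplex

variable {k : Type u} [Field k] {τ : Type} {V : Type} [LinearOrder V]
  {Δ : PreAbstractSimplicialComplex V}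

/-- A resolution with `β n = 0` would force the nonzero module of `n`-chains to have rank zero. -/
theorem not_supportsMinimalFreeResolution {label : V → τ →₀ ℕ} {I : Ideal (MvPolynomial τ k)}
    {n : ℕ} (hI : FiniteFreeDimLT (MvPolynomial τ k) n I) {σ : Finset V} (hσ : σ ∈ Δ.faces)
    (hn : σ.card = n + 1) : ¬ Δ.SupportsMinimalFreeResolution label I := by
  rintro ⟨-, h⟩
  obtain ⟨β, d, ε, hβ, hr⟩ := hI.exists_isIdealResolution
  have h0 := h β d ε ⟨n, fun j hj => hβ j hj.le⟩ hr n
  rw [hβ n le_rfl, Nat.cast_zero, nonpos_iff_eq_zero, rank_zero_iff] at h0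
  have : Nontrivial (Δ.FaceOfDim n →₀ MvPolynomial τ k) :=
    have : Nonempty (Δ.FaceOfDim n) := ⟨⟨σ, hσ, hn⟩⟩
    inferInstance
  exact not_subsingleton _ h0

theorem le_dimension {V : Type*} {Δ : PreAbstractSimplicialComplex V}
    {σ : Finset V} (hσ : σ ∈ Δ.faces) {n : ℕ} (hn : σ.card = n + 1) :
    (n : WithBot ℕ∞) ≤ Δ.dimension := by
  refine le_trans (le_of_eq ?_) (le_iSup₂ (f := fun (σ : Finset V) (_ : σ ∈ Δ.faces) =>
    ((σ.card - 1 : ℕ) : WithBot ℕ∞)) σ hσ)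
  rw [hn, Nat.add_sub_cancel]

theorem projectiveDimension_ne_dimension {V : Type*} {Δ : PreAbstractSimplicialComplex V}
    {I : Ideal (MvPolynomial τ k)}
    {n : ℕ} (hI : FiniteFreeDimLT (MvPolynomial τ k) n I) {σ : Finset V} (hσ : σ ∈ Δ.faces)
    (hn : σ.card = n + 1) :
    CategoryTheory.projectiveDimension (ModuleCat.of (MvPolynomial τ k) I) ≠ Δ.dimension := by
  have h1 := CategoryTheory.projectiveDimension_lt_iff.2 hI.hasProjectiveDimensionLT
  exact (h1.trans_le (le_dimension hσ hn)).ne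

end PreAbstractSimplicialComplex

/-- Outside the listed cases, `ℰ_q ^ r` has a resolution which is shorter than the dimension of
`𝕃^r_q`. -/
theorem exists_face_of_not_small (k : Type u) [Field k] {r q : ℕ} (hr : 1 ≤ r) (hq : 1 ≤ q)
    (h : ¬ ((q = 1 ∧ 1 ≤ r) ∨ (q = 2 ∧ 1 ≤ r ∧ r ≤ 4) ∨ (3 ≤ q ∧ 1 ≤ r ∧ r ≤ 2))) :
    ∃ n, FiniteFreeDimLT (ExtremalRing k q) n ↥(extremalIdeal k q ^ r) ∧
      ∃ σ ∈ (LComplex r q).faces, σ.card = n + 1 := by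
  classical
  obtain hq3 | hq3 := le_or_gt 3 q
  · obtain ⟨i, hi, hf⟩ := exists_finiteFreeDimLT_extremalIdeal_pow k (r := r) (by omega) hq3
    have hfin := (firstLayer r q i).toFinite
    have hcard : hfin.toFinset.card = (firstLayer r q i).ncard :=
      (Set.ncard_eq_toFinset_card _ hfin).symm
    refine ⟨_, hf, hfin.toFinset, ⟨Finset.card_pos.1 (by omega), i, Or.inl (by simp)⟩, by omega⟩
  · obtain rfl : q = 2 := by omega
    have hr5 : 5 ≤ r := by omega
    -- The points `(r-1, 1)`, `(r-2, 2)`, `(r-3, 3)` span a triangle in `F_0`, since `r ≥ 5` gives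
    -- `s ≥ 3`.
    obtain ⟨a, ha, ha'⟩ := exists_coord_eq (r := r) (t := r - 1) (by omega)
    obtain ⟨b, hb, hb'⟩ := exists_coord_eq (r := r) (t := r - 2) (by omega)
    obtain ⟨c, hc, hc'⟩ := exists_coord_eq (r := r) (t := r - 3) (by omega)
    refine ⟨2, finiteFreeDimLT_extremalIdeal_two_pow k r, {a, b, c},
      ⟨⟨a, by simp⟩, 0, Or.inl ?_⟩, ?_⟩
    · have hj : ∀ j : Fin 2, j ≠ 0 → j = 1 := by decide
      intro x hx
      simp only [Finset.coe_insert, Finset.coe_singleton, Set.mem_insert_iff,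
        Set.mem_singleton_iff] at hx
      obtain rfl | rfl | rfl := hx
      all_goals
        refine ⟨by omega, fun j hj0 => ?_⟩
        rw [hj j hj0]
        omega
    · refine Finset.card_eq_three.2 ⟨a, b, c, ?_, ?_, ?_, rfl⟩
      all_goals
        rintro rfl
        omega
end

noncomputable section
universe u

/-! ### Minimal resolutions -/

/-- `⋯ → F 1 → F 0 → M → 0` is exact. -/
structure IsResolution {S : Type*} [CommRing S] (M : Type*) [AddCommGroup M] [Module S M]
    (F : ℕ → Type*) [∀ n, AddCommGroup (F n)] [∀ n, Module S (F n)]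
    (d : ∀ n, F (n + 1) →ₗ[S] F n) (ε : F 0 →ₗ[S] M) : Prop where
  surjective_aug : Function.Surjective ε
  exact_aug : Function.Exact (d 0) ε
  exact_succ : ∀ n, Function.Exact (d (n + 1)) (d n)

namespace IsResolution

variable {S : Type u} [CommRing S] {M : Type u} [AddCommGroup M] [Module S M]
  {F : ℕ → Type u} [∀ n, AddCommGroup (F n)] [∀ n, Module S (F n)]
  {d : ∀ n, F (n + 1) →ₗ[S] F n} {ε : F 0 →ₗ[S] M}
  {N : Type u} [AddCommGroup N] [Module S N]
  {G : ℕ → Type u} [∀ n, AddCommGroup (G n)] [∀ n, Module S (G n)]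
  {d' : ∀ n, G (n + 1) →ₗ[S] G n} {ε' : G 0 →ₗ[S] N}

/-- The augmentation of the shifted resolution, which resolves the first syzygy module. -/
def shiftAug (h : IsResolution M F d ε) : F 1 →ₗ[S] LinearMap.ker ε :=
  LinearMap.codRestrict _ (d 0) fun x => (h.exact_aug _).2 ⟨x, rfl⟩

theorem shift (h : IsResolution M F d ε) :
    IsResolution (LinearMap.ker ε) (fun n => F (n + 1)) (fun n => d (n + 1)) h.shiftAug where
  surjective_aug := by
    rintro ⟨x, hx⟩
    obtain ⟨y, rfl⟩ := (h.exact_aug x).1 hx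
    exact ⟨y, rfl⟩
  exact_aug := fun x =>
    ⟨fun hx => (h.exact_succ 0 x).1 (congrArg Subtype.val hx),
      fun hx => Subtype.ext ((h.exact_succ 0 x).2 hx)⟩
  exact_succ := fun n => h.exact_succ (n + 1)

/-- The `n`-th syzygy module is a quotient of `F n = 0`; later terms are irrelevant. -/
theorem finiteFreeDimLT [∀ n, Module.Free S (F n)] [∀ n, Module.Finite S (F n)] {n : ℕ}
    (h : IsResolution M F d ε) (hn : Subsingleton (F n)) : FiniteFreeDimLT S n M := by
  induction n generalizing M F with
  | zero =>
    have := h.surjective_aug.subsingleton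
    exact FiniteFreeDimLT.of_subsingleton
  | succ n ih =>
    cases subsingleton_or_nontrivial S
    · have : Subsingleton M := Module.subsingleton S M
      exact FiniteFreeDimLT.of_subsingleton.mono (Nat.zero_le _)
    exact FiniteFreeDimLT.of_surjective (Module.Free.chooseBasis S (F 0)) ε h.surjective_aug
      (ih h.shift hn)

/-- Lifting of `α : M → N` and `β : N → M` to projective covers, where `β ∘ α` differs from the
identity by a map factoring through a projective module `P`. -/
theorem exists_lift {F G P : Type u} [AddCommGroup F] [Module S F] [AddCommGroup G] [Module S G]
    [AddCommGroup P] [Module S P] [Module.Projective S F] [Module.Projective S G]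
    [Module.Projective S P] {ε : F →ₗ[S] M} {ε' : G →ₗ[S] N} (hε : Function.Surjective ε)
    (hε' : Function.Surjective ε') (α : M →ₗ[S] N) (β : N →ₗ[S] M) (ι : M →ₗ[S] P)
    (h : P →ₗ[S] M) (hαβ : ∀ x, β (α x) - x = h (ι x)) :
    ∃ (a : F →ₗ[S] G) (b : G →ₗ[S] F) (h' : P →ₗ[S] F) (g : F →ₗ[S] LinearMap.ker ε),
      (∀ x, ε' (a x) = α (ε x)) ∧ (∀ x, ε (b x) = β (ε' x)) ∧
      ∀ x, b (a x) - x = h' (ι (ε x)) + g x := by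
  obtain ⟨a, ha⟩ := Module.projective_lifting_property ε' (α ∘ₗ ε) hε'
  obtain ⟨b, hb⟩ := Module.projective_lifting_property ε (β ∘ₗ ε') hε
  obtain ⟨h', hh⟩ := Module.projective_lifting_property ε h hε
  replace ha : ∀ x, ε' (a x) = α (ε x) := fun x => LinearMap.congr_fun ha x
  replace hb : ∀ x, ε (b x) = β (ε' x) := fun x => LinearMap.congr_fun hb x
  replace hh : ∀ x, ε (h' x) = h x := fun x => LinearMap.congr_fun hh x
  refine ⟨a, b, h', LinearMap.codRestrict _ (b ∘ₗ a - LinearMap.id - h' ∘ₗ ι ∘ₗ ε) ?_, ha, hb, ?_⟩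
  · intro x
    simp [hb, ha, hh, hαβ]
  · intro x
    simp

theorem smul_top_map (𝔪 : Ideal S) (f : M →ₗ[S] N) {x : M}
    (hx : x ∈ 𝔪 • (⊤ : Submodule S M)) : f x ∈ 𝔪 • (⊤ : Submodule S N) :=
  Submodule.smul_top_le_comap_smul_top 𝔪 f hx

/-- Comparison of a minimal resolution with an arbitrary one. -/
theorem exists_comparison (𝔪 : Ideal S) [∀ n, Module.Projective S (F n)]
    [∀ n, Module.Projective S (G n)] (hF : IsResolution M F d ε) (hG : IsResolution N G d' ε')
    (hd : ∀ n x, d n x ∈ 𝔪 • (⊤ : Submodule S (F n)))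
    {P : Type u} [AddCommGroup P] [Module S P] [Module.Projective S P]
    (α : M →ₗ[S] N) (β : N →ₗ[S] M) (ι : M →ₗ[S] P)
    (hι : ∀ x, ι x ∈ 𝔪 • (⊤ : Submodule S P))
    (h : P →ₗ[S] M) (hαβ : ∀ x, β (α x) - x = h (ι x)) (j : ℕ) :
    ∃ (a : F j →ₗ[S] G j) (b : G j →ₗ[S] F j),
      ∀ x, b (a x) - x ∈ 𝔪 • (⊤ : Submodule S (F j)) := by
  induction j generalizing M N F G P with
  | zero =>
    obtain ⟨a, b, h', g, -, -, hab⟩ :=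
      exists_lift hF.surjective_aug hG.surjective_aug α β ι h hαβ
    refine ⟨a, b, fun x => ?_⟩
    rw [hab]
    refine add_mem (smul_top_map 𝔪 h' (hι _)) ?_
    obtain ⟨y, hy⟩ := (hF.exact_aug (g x)).1 (g x).2
    rw [← hy]
    exact hd 0 y
  | succ j ih =>
    obtain ⟨a, b, h', g, ha, hb, hab⟩ :=
      exists_lift hF.surjective_aug hG.surjective_aug α β ι h hαβ
    have hker : ∀ x ∈ LinearMap.ker ε, x ∈ 𝔪 • (⊤ : Submodule S (F 0)) := fun x hx => by
      obtain ⟨y, rfl⟩ := (hF.exact_aug x).1 hx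
      exact hd 0 y
    -- On `ker ε` the term `h' ∘ ι ∘ ε` vanishes, so the defect of the restricted maps is `g`
    -- composed with the inclusion into `F 0`. That inclusion plays the role of `ι` at the next
    -- stage: its image `range (d 0)` lies in `𝔪 F 0`.
    exact ih hF.shift hG.shift (fun n => hd (n + 1))
      (a.restrict (p := LinearMap.ker ε) (q := LinearMap.ker ε') fun x hx => by
        rw [LinearMap.mem_ker, ha, LinearMap.mem_ker.1 hx, map_zero])
      (b.restrict (p := LinearMap.ker ε') (q := LinearMap.ker ε) fun x hx => by
        rw [LinearMap.mem_ker, hb, LinearMap.mem_ker.1 hx, map_zero])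
      (LinearMap.ker ε).subtype (fun x => hker x x.2) g fun x => Subtype.ext (by
        have := hab x
        rw [LinearMap.mem_ker.1 x.2, map_zero, map_zero, zero_add] at this
        exact this)

/-- The matrix of `f` is the identity modulo `𝔪`, so its determinant is `1` modulo `𝔪` and hence
nonzero. Over a domain this suffices; neither a local ring nor a grading is needed. -/
theorem injective_of_sub_mem_smul_top [IsDomain S] {𝔪 : Ideal S} (hm : 𝔪 ≠ ⊤)
    [Module.Free S M] [Module.Finite S M] (f : M →ₗ[S] M)
    (hf : ∀ x, f x - x ∈ 𝔪 • (⊤ : Submodule S M)) : Function.Injective f := by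
  classical
  let b := Module.Free.chooseBasis S M
  have hA : (LinearMap.toMatrix b b f).map (Ideal.Quotient.mk 𝔪) = 1 := by
    ext i j
    have h1 : b.coord i (f (b j) - b j) ∈ 𝔪 := by
      simpa using smul_top_map 𝔪 (b.coord i) (hf (b j))
    rw [map_sub, ← Ideal.Quotient.eq] at h1
    simp only [Matrix.map_apply, LinearMap.toMatrix_apply]
    refine h1.trans ?_
    by_cases hij : i = j
    · subst hij; simp
    · simp [hij]
  have hdet : (LinearMap.toMatrix b b f).det ≠ 0 := by
    intro h0
    have h1 := RingHom.map_det (Ideal.Quotient.mk 𝔪) (LinearMap.toMatrix b b f)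
    rw [h0, map_zero, RingHom.mapMatrix_apply, hA, Matrix.det_one] at h1
    have := Ideal.Quotient.nontrivial_iff.2 hm
    exact zero_ne_one h1
  rw [injective_iff_map_eq_zero]
  intro x hx
  have h1 : (LinearMap.toMatrix b b f).mulVec (b.repr x) = 0 := by
    rw [LinearMap.toMatrix_mulVec_repr, hx, map_zero, Finsupp.coe_zero]
  have h2 : ⇑(b.repr x) = 0 := Matrix.mulVec_injective_of_det_mem_nonZeroDivisors
    (mem_nonZeroDivisors_of_ne_zero hdet) (by rw [h1, Matrix.mulVec_zero])
  exact b.repr.map_eq_zero_iff.1 (DFunLike.coe_injective h2)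

theorem rank_le [IsDomain S] {𝔪 : Ideal S} (hm : 𝔪 ≠ ⊤) [∀ n, Module.Free S (F n)]
    [∀ n, Module.Finite S (F n)] [∀ n, Module.Projective S (G n)]
    {ε' : G 0 →ₗ[S] M} (hF : IsResolution M F d ε) (hG : IsResolution M G d' ε')
    (hd : ∀ n x, d n x ∈ 𝔪 • (⊤ : Submodule S (F n))) (j : ℕ) :
    Module.rank S (F j) ≤ Module.rank S (G j) := by
  obtain ⟨a, b, hab⟩ := exists_comparison 𝔪 hF hG hd (P := S) LinearMap.id LinearMap.id 0
    (fun x => zero_mem _) 0 (fun x => by simp) j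
  have hinj : Function.Injective (b ∘ₗ a) := injective_of_sub_mem_smul_top hm _ hab
  exact LinearMap.rank_le_of_injective a (Function.Injective.of_comp hinj)

open CategoryTheory in
/-- The length of a minimal resolution is a lower bound for the projective dimension. -/
theorem not_hasProjectiveDimensionLT (𝔪 : Ideal S) [∀ n, Module.Projective S (F n)]
    (hF : IsResolution M F d ε) (hd : ∀ n x, d n x ∈ 𝔪 • (⊤ : Submodule S (F n))) {n : ℕ}
    (hn : 𝔪 • (⊤ : Submodule S (F n)) ≠ ⊤) (hn' : Subsingleton (F (n + 1))) :
    ¬ HasProjectiveDimensionLT (ModuleCat.of S M) n := by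
  induction n generalizing M F with
  | zero =>
    intro h
    have hM := ModuleCat.subsingleton_of_isZero
      ((hasProjectiveDimensionLT_zero_iff_isZero _).1 h)
    refine hn (top_le_iff.1 fun x _ => ?_)
    obtain ⟨y, rfl⟩ := (hF.exact_aug x).1 (Subsingleton.elim (α := M) _ _)
    exact hd 0 y
  | succ n ih =>
    intro h
    obtain _ | n := n
    · have hproj : Module.Projective S M := by
        rw [IsProjective.iff_projective]
        exact projective_iff_hasProjectiveDimensionLT_one.2 h
      -- Here `F 2 = 0` gives `F 1 ≅ ker ε`, and the splitting of `ε` yields a retraction of `d 0`.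
      -- Then `F 1` is the image of `range (d 0) ⊆ 𝔪 F 0`, so `F 1 = 𝔪 F 1`.
      obtain ⟨s, hs⟩ := Module.projective_lifting_property ε LinearMap.id hF.surjective_aug
      replace hs : ∀ x, ε (s x) = x := fun x => LinearMap.congr_fun hs x
      have hbij : Function.Bijective hF.shiftAug := by
        refine ⟨(injective_iff_map_eq_zero _).2 fun x hx => ?_, hF.shift.surjective_aug⟩
        obtain ⟨y, rfl⟩ := (hF.shift.exact_aug x).1 hx
        rw [Subsingleton.elim (α := F (0 + 1 + 1)) y 0, map_zero]
      let p : F 0 →ₗ[S] LinearMap.ker ε :=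
        LinearMap.codRestrict _ (LinearMap.id - s ∘ₗ ε) fun x => by simp [hs]
      refine hn (top_le_iff.1 fun x _ => ?_)
      have hx : ((LinearEquiv.ofBijective _ hbij).symm.toLinearMap ∘ₗ p) (d 0 x) = x := by
        rw [LinearMap.comp_apply, LinearEquiv.coe_coe, LinearEquiv.symm_apply_eq]
        refine Subtype.ext ?_
        have h0 : ε (d 0 x) = 0 := (hF.exact_aug _).2 ⟨x, rfl⟩
        simp only [p, LinearMap.codRestrict_apply, LinearMap.sub_apply, LinearMap.comp_apply,
          LinearMap.id_apply, h0, map_zero, sub_zero]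
        rfl
      rw [← hx]
      exact smul_top_map 𝔪 _ (hd 0 x)
    · refine ih hF.shift (fun n => hd (n + 1)) hn hn' ?_
      have hS : (ModuleCat.ofHom (LinearMap.ker ε).subtype) ≫ ModuleCat.ofHom ε = 0 := by
        ext x; simp
      have hse : (ShortComplex.mk _ _ hS).ShortExact :=
        { exact := by
            rw [ShortComplex.ShortExact.moduleCat_exact_iff_function_exact]
            exact LinearMap.exact_subtype_ker_map ε
          mono_f := (ModuleCat.mono_iff_injective _).2 Subtype.val_injective
          epi_g := (ModuleCat.epi_iff_surjective _).2 hF.surjective_aug }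
      have : Projective (ModuleCat.of S (F 0)) :=
        (IsProjective.iff_projective _).1 inferInstance
      exact hse.hasProjectiveDimensionLT_X₁ (n + 1)
        (hasProjectiveDimensionLT_of_ge _ 1 _ (by omega)) h

end IsResolution

theorem IsIdealResolution.isResolution {S : Type u} [CommRing S] {I : Ideal S} {F : ℕ → Type u}
    [∀ n, AddCommGroup (F n)] [∀ n, Module S (F n)] {d : ∀ n, F (n + 1) →ₗ[S] F n}
    {ε : F 0 →ₗ[S] S} (h : IsIdealResolution I F d ε) :
    IsResolution I F d (LinearMap.codRestrict I ε fun x => h.range_aug ▸ ⟨x, rfl⟩) where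
  surjective_aug := by
    rintro ⟨x, hx⟩
    obtain ⟨y, rfl⟩ : x ∈ LinearMap.range ε := h.range_aug ▸ hx
    exact ⟨y, rfl⟩
  exact_aug := fun x =>
    ⟨fun hx => (h.exact_aug x).1 (congrArg Subtype.val hx),
      fun hx => Subtype.ext ((h.exact_aug x).2 hx)⟩
  exact_succ := h.exact_succ

theorem IsIdealResolution.isMinimalIdealResolution {S : Type u} [CommRing S] [IsDomain S]
    {I : Ideal S} {F : ℕ → Type u} [∀ n, AddCommGroup (F n)] [∀ n, Module S (F n)]
    [∀ n, Module.Free S (F n)] [∀ n, Module.Finite S (F n)] {d : ∀ n, F (n + 1) →ₗ[S] F n}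
    {ε : F 0 →ₗ[S] S} (h : IsIdealResolution I F d ε) {𝔪 : Ideal S} (hm : 𝔪 ≠ ⊤)
    (hd : ∀ n x, d n x ∈ 𝔪 • (⊤ : Submodule S (F n))) :
    IsMinimalIdealResolution I F d ε := by
  refine ⟨h, fun β d' ε' _ h' j => ?_⟩
  simpa using h.isResolution.rank_le hm h'.isResolution hd j
end

noncomputable section
universe u

/-! ### Simplicial chains on the finite subsets of a linearly ordered set -/

namespace SimplicialChain

variable {V R : Type*} [CommRing R]

theorem map_mem_supported {s t : Set (Finset V)} (f : (Finset V →₀ R) →ₗ[R] (Finset V →₀ R))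
    (hf : ∀ σ ∈ s, f (Finsupp.single σ 1) ∈ Finsupp.supported R R t) {z : Finset V →₀ R}
    (hz : z ∈ Finsupp.supported R R s) : f z ∈ Finsupp.supported R R t := by
  rw [Finsupp.supported_eq_span_single] at hz
  suffices h : Submodule.span R _ ≤ (Finsupp.supported R R t).comap f from h hz
  rw [Submodule.span_le]
  rintro _ ⟨σ, hσ, rfl⟩
  exact hf σ hσ

/-- Chains on the members of `K` with `n` elements. -/
def chains (R : Type*) [CommRing R] (K : Set (Finset V)) (n : ℕ) : Submodule R (Finset V →₀ R) :=
  Finsupp.supported R R {σ | σ ∈ K ∧ σ.card = n}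

variable [LinearOrder V]

/-- The sign `(-1) ^ j`, where `j` is the number of elements of `σ` below `v`. -/
def sgn (R : Type*) [CommRing R] (σ : Finset V) (v : V) : R := (-1) ^ (σ.filter (· < v)).card

theorem sgn_mul_self (σ : Finset V) (v : V) : sgn R σ v * sgn R σ v = 1 := by
  rw [sgn, ← mul_pow, neg_one_mul, neg_neg, one_pow]

theorem sgn_insert (σ : Finset V) {u : V} (hu : u ∉ σ) (v : V) :
    sgn R (insert u σ) v = (if u < v then -1 else 1) * sgn R σ v := by
  rw [sgn, Finset.filter_insert]
  split_ifs with h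
  · rw [Finset.card_insert_of_notMem (by simp [hu]), pow_succ', sgn]
  · rw [one_mul, sgn]

/-- Inserting `u` and deleting `v` anticommute; this cancels the cross terms in `bd_cone`. -/
theorem sgn_insert_mul_sgn {σ : Finset V} {u v : V} (hu : u ∉ σ) (hv : v ∈ σ) :
    sgn R σ u * sgn R (insert u σ) v = -(sgn R σ v * sgn R (σ.erase v) u) := by
  have h1 : sgn R σ u = (if v < u then -1 else 1) * sgn R (σ.erase v) u := by
    conv_lhs => rw [← Finset.insert_erase hv]
    exact sgn_insert _ (Finset.notMem_erase v σ) u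
  rw [h1, sgn_insert σ hu]
  have huv : u ≠ v := fun h => hu (h ▸ hv)
  obtain h | h := huv.lt_or_gt
  · rw [if_neg h.not_gt, if_pos h]; ring
  · rw [if_pos h, if_neg h.not_gt]; ring

/-- The augmented simplicial boundary map. -/
def bd (V R : Type*) [LinearOrder V] [CommRing R] : (Finset V →₀ R) →ₗ[R] (Finset V →₀ R) :=
  Finsupp.linearCombination R fun σ => ∑ v ∈ σ, Finsupp.single (σ.erase v) (sgn R σ v)

theorem bd_single (σ : Finset V) (c : R) : bd V R (Finsupp.single σ c) =
    ∑ v ∈ σ, Finsupp.single (σ.erase v) (sgn R σ v * c) := by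
  simp [bd, Finsupp.linearCombination_single, Finset.smul_sum, mul_comm]

/-- The cone operator with apex `u`. -/
def cone (R : Type*) [CommRing R] (u : V) : (Finset V →₀ R) →ₗ[R] (Finset V →₀ R) :=
  Finsupp.linearCombination R fun σ =>
    if u ∈ σ then 0 else Finsupp.single (insert u σ) (sgn R σ u)

theorem cone_single_of_mem {u : V} {σ : Finset V} (hu : u ∈ σ) (c : R) :
    cone R u (Finsupp.single σ c) = 0 := by
  rw [cone, Finsupp.linearCombination_single, if_pos hu, smul_zero]

theorem cone_single_of_notMem {u : V} {σ : Finset V} (hu : u ∉ σ) (c : R) :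
    cone R u (Finsupp.single σ c) = Finsupp.single (insert u σ) (sgn R σ u * c) := by
  rw [cone, Finsupp.linearCombination_single, if_neg hu, Finsupp.smul_single, smul_eq_mul,
    mul_comm]

/-- The cone is a contracting homotopy of the full simplex. If `u ∈ σ`, only the facet opposite `u`
contributes; otherwise all terms but `σ` cancel in pairs. -/
theorem bd_cone (u : V) (z : Finset V →₀ R) :
    bd V R (cone R u z) = z - cone R u (bd V R z) := by
  induction z using Finsupp.induction_linear with
  | zero => simp
  | add x y hx hy => rw [map_add, map_add, map_add, map_add, hx, hy]; abel
  | single σ c =>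
    rw [bd_single, map_sum, eq_sub_iff_add_eq]
    by_cases hu : u ∈ σ
    · rw [cone_single_of_mem hu, map_zero, zero_add, Finset.sum_eq_single_of_mem u hu,
        cone_single_of_notMem (Finset.notMem_erase u σ), Finset.insert_erase hu, ← mul_assoc]
      · have : sgn R (σ.erase u) u = sgn R σ u := by
          conv_rhs => rw [← Finset.insert_erase hu]
          rw [sgn_insert _ (Finset.notMem_erase u σ), if_neg (lt_irrefl u), one_mul]
        rw [this, sgn_mul_self, one_mul]
      · intro v _ hv
        exact cone_single_of_mem (Finset.mem_erase.2 ⟨hv.symm, hu⟩) _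
    · rw [cone_single_of_notMem hu, bd_single, Finset.sum_insert hu, Finset.erase_insert hu,
        sgn_insert _ hu, if_neg (lt_irrefl u), one_mul, ← mul_assoc, sgn_mul_self, one_mul,
        add_assoc, ← Finset.sum_add_distrib, add_eq_left]
      refine Finset.sum_eq_zero fun v hv => ?_
      have huv : u ≠ v := fun h => hu (h ▸ hv)
      have hu' : u ∉ σ.erase v := fun h => hu (Finset.mem_of_mem_erase h)
      rw [cone_single_of_notMem hu', Finset.erase_insert_of_ne huv, ← Finsupp.single_add,
        ← mul_assoc, ← mul_assoc, mul_comm (sgn R _ v), sgn_insert_mul_sgn hu hv,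
        mul_comm (sgn R (σ.erase v) u), neg_mul, neg_add_cancel, Finsupp.single_zero]

/-- A nonempty simplex is, up to sign, a cone over a smaller one, so `bd_cone` replaces the usual
double sum. -/
theorem bd_bd (z : Finset V →₀ R) : bd V R (bd V R z) = 0 := by
  induction z using Finsupp.induction_linear with
  | zero => simp
  | add x y hx hy => rw [map_add, map_add, hx, hy, add_zero]
  | single σ c =>
    induction σ using Finset.induction_on generalizing c with
    | empty => rw [bd_single, Finset.sum_empty, map_zero]
    | insert u σ hu ih =>
      have : Finsupp.single (insert u σ) c =
          cone R u (Finsupp.single σ (sgn R σ u * c)) := by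
        rw [cone_single_of_notMem hu, ← mul_assoc, sgn_mul_self, one_mul]
      rw [this, bd_cone, map_sub, bd_cone, ih, map_zero, sub_zero, sub_self]

/-- Additivity suffices because the boundary coefficients are `±1`. The applications are coefficient
extraction and `monomial m`, which are not ring homomorphisms. -/
theorem bd_mapRange {R' : Type*} [CommRing R'] (f : R →+ R') (z : Finset V →₀ R) :
    bd V R' (Finsupp.mapRange.addMonoidHom f z) =
      Finsupp.mapRange.addMonoidHom f (bd V R z) := by
  induction z using Finsupp.induction_linear with
  | zero => simp
  | add x y hx hy => rw [map_add, map_add, map_add, map_add, hx, hy]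
  | single σ c =>
    rw [bd_single, map_sum, Finsupp.mapRange.addMonoidHom_apply, Finsupp.mapRange_single,
      bd_single]
    refine Finset.sum_congr rfl fun v _ => ?_
    rw [Finsupp.mapRange.addMonoidHom_apply, Finsupp.mapRange_single]
    congr 1
    obtain h | h := Nat.even_or_odd (σ.filter (· < v)).card
    · rw [sgn, sgn, h.neg_one_pow, h.neg_one_pow, one_mul, one_mul]
    · rw [sgn, sgn, h.neg_one_pow, h.neg_one_pow, neg_one_mul, neg_one_mul, map_neg]

theorem bd_mem_supported {s t : Set (Finset V)} (h : ∀ σ ∈ s, ∀ v ∈ σ, σ.erase v ∈ t)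
    {z : Finset V →₀ R} (hz : z ∈ Finsupp.supported R R s) :
    bd V R z ∈ Finsupp.supported R R t := by
  refine map_mem_supported _ (fun σ hσ => ?_) hz
  rw [bd_single]
  exact Submodule.sum_mem _ fun v hv => Finsupp.single_mem_supported R _ (h σ hσ v hv)

theorem cone_mem_supported {s t : Set (Finset V)} {u : V}
    (h : ∀ σ ∈ s, u ∉ σ → insert u σ ∈ t) {z : Finset V →₀ R}
    (hz : z ∈ Finsupp.supported R R s) : cone R u z ∈ Finsupp.supported R R t := by
  refine map_mem_supported _ (fun σ hσ => ?_) hz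
  by_cases hu : u ∈ σ
  · rw [cone_single_of_mem hu]
    exact zero_mem _
  · rw [cone_single_of_notMem hu]
    exact Finsupp.single_mem_supported R _ (h σ hσ hu)

/-- The reduced homology of `K` vanishes in all nonnegative degrees. -/
def Acyclic (R : Type*) [CommRing R] (K : Set (Finset V)) : Prop :=
  ∀ n, ∀ z ∈ chains R K (n + 1), bd V R z = 0 → ∃ y ∈ chains R K (n + 2), bd V R y = z

theorem acyclic_of_cone {K : Set (Finset V)} (u : V) (h : ∀ σ ∈ K, insert u σ ∈ K) :
    Acyclic R K := by
  intro n z hz hz0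
  refine ⟨cone R u z, cone_mem_supported ?_ hz, by rw [bd_cone, hz0, map_zero, sub_zero]⟩
  rintro σ ⟨hσ, hn⟩ hu
  exact ⟨h σ hσ, by rw [Finset.card_insert_of_notMem hu, hn]⟩

/-- Removing a vertex `v` dominated by a vertex `u`. -/
theorem acyclic_of_dominated {K : Set (Finset V)} (hK : ∀ σ ∈ K, ∀ τ ⊆ σ, τ ∈ K) {u v : V}
    (huv : u ≠ v) (h : ∀ σ ∈ K, v ∈ σ → insert u σ ∈ K)
    (hA : Acyclic R {σ | σ ∈ K ∧ v ∉ σ}) : Acyclic R K := by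
  classical
  intro n z hz hz0
  -- Subtracting the boundary of `cone u z₁` replaces `z` by `z₀ + cone u (∂ z₁)`. This cycle avoids
  -- `v`, because `∂ z₁ = -∂ z₀` does.
  set z₁ := z.filter (v ∈ ·) with hz₁
  set z₀ := z.filter (fun σ => ¬ v ∈ σ) with hz₀
  have hsum : z₁ + z₀ = z := Finsupp.filter_add_filter_not _ _
  have hsupp : ∀ σ ∈ z.support, σ ∈ K ∧ σ.card = n + 1 := fun σ hσ =>
    (Finsupp.mem_supported R z).1 hz hσ
  have h₁ : z₁ ∈ Finsupp.supported R R {σ | σ ∈ K ∧ v ∈ σ ∧ σ.card = n + 1} := by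
    rw [Finsupp.mem_supported]
    intro σ hσ
    rw [hz₁, Finsupp.support_filter, Finset.coe_filter] at hσ
    exact ⟨(hsupp σ hσ.1).1, hσ.2, (hsupp σ hσ.1).2⟩
  have h₀ : z₀ ∈ Finsupp.supported R R {σ | (σ ∈ K ∧ v ∉ σ) ∧ σ.card = n + 1} := by
    rw [Finsupp.mem_supported]
    intro σ hσ
    rw [hz₀, Finsupp.support_filter, Finset.coe_filter] at hσ
    exact ⟨⟨(hsupp σ hσ.1).1, hσ.2⟩, (hsupp σ hσ.1).2⟩
  have hcone : cone R u z₁ ∈ chains R K (n + 2) := by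
    refine cone_mem_supported ?_ h₁
    rintro σ ⟨hσ, hv, hn⟩ hu
    exact ⟨h σ hσ hv, by rw [Finset.card_insert_of_notMem hu, hn]⟩
  have hbd : bd V R z₁ ∈ Finsupp.supported R R
      ({τ | insert u τ ∈ K ∧ τ.card = n} ∩ {τ | v ∉ τ}) := by
    rw [Finsupp.supported_inter, Submodule.mem_inf]
    constructor
    · refine bd_mem_supported ?_ h₁
      rintro σ ⟨hσ, hv, hn⟩ w hw
      exact ⟨hK _ (h σ hσ hv) _ (Finset.insert_subset_insert _ (Finset.erase_subset _ _)),
        by rw [Finset.card_erase_of_mem hw, hn, Nat.add_sub_cancel]⟩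
    · have : bd V R z₁ = -bd V R z₀ := by
        rw [eq_neg_iff_add_eq_zero, ← map_add, hsum, hz0]
      rw [this]
      refine neg_mem (bd_mem_supported ?_ h₀)
      rintro σ ⟨⟨-, hv⟩, -⟩ w _ hvw
      exact hv (Finset.mem_of_mem_erase hvw)
  have hmem : z₀ + cone R u (bd V R z₁) ∈ chains R {σ | σ ∈ K ∧ v ∉ σ} (n + 1) := by
    refine add_mem h₀ (cone_mem_supported ?_ hbd)
    rintro τ ⟨⟨hτ, hn⟩, hv⟩ hu
    refine ⟨⟨hτ, ?_⟩, by rw [Finset.card_insert_of_notMem hu, hn]⟩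
    rw [Finset.mem_insert, not_or]
    exact ⟨huv.symm, hv⟩
  have hzero : bd V R (z₀ + cone R u (bd V R z₁)) = 0 := by
    rw [map_add, bd_cone, bd_bd, map_zero, sub_zero, ← map_add, add_comm, hsum, hz0]
  obtain ⟨y, hy, hyz⟩ := hA n _ hmem hzero
  refine ⟨cone R u z₁ + y, add_mem hcone ?_, ?_⟩
  · have hsub : {σ | σ ∈ {σ | σ ∈ K ∧ v ∉ σ} ∧ σ.card = n + 2} ⊆
        {σ | σ ∈ K ∧ σ.card = n + 2} := fun σ hσ => ⟨hσ.1.1, hσ.2⟩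
    exact Finsupp.supported_mono hsub hy
  · rw [map_add, hyz, bd_cone, ← hsum]
    abel

end SimplicialChain

open SimplicialChain

/-! ### Multigraded strands of the homogenized complex, and dismantlability. -/

namespace PreAbstractSimplicialComplex

variable {V : Type*}

/-- The faces of `Δ` contained in `W`, together with the empty set. -/
def facesIn (Δ : PreAbstractSimplicialComplex V) (W : Finset V) : Set (Finset V) :=
  {σ | σ ⊆ W ∧ (σ = ∅ ∨ σ ∈ Δ.faces)}

theorem facesIn_subset {Δ : PreAbstractSimplicialComplex V} {W σ τ : Finset V}
    (hσ : σ ∈ Δ.facesIn W) (hτ : τ ⊆ σ) : τ ∈ Δ.facesIn W := by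
  refine ⟨hτ.trans hσ.1, ?_⟩
  obtain rfl | hne := τ.eq_empty_or_nonempty
  · exact Or.inl rfl
  · obtain rfl | h := hσ.2
    · exact absurd (Finset.subset_empty.1 hτ) hne.ne_empty
    · exact Or.inr ((Δ.isRelLowerSet_faces h).2 hτ hne)

variable {k : Type*} [Field k] {τ : Type*} {Δ : PreAbstractSimplicialComplex V}
  {label : V → τ →₀ ℕ}

/-- The embedding of the homogenized chains into the simplicial chains, which multiplies
`e_σ` by its label. -/
def dehomogenize (k : Type*) [Field k] (Δ : PreAbstractSimplicialComplex V)
    (label : V → τ →₀ ℕ) (n : ℕ) :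
    Chain k τ Δ n →ₗ[MvPolynomial τ k] (Finset V →₀ MvPolynomial τ k) :=
  Finsupp.linearCombination _ fun σ : Δ.FaceOfDim n =>
    Finsupp.single σ.1 (MvPolynomial.monomial (faceLabel label σ.1) 1)

theorem dehomogenize_single {n : ℕ} (σ : Δ.FaceOfDim n) (p : MvPolynomial τ k) :
    dehomogenize k Δ label n (Finsupp.single σ p) =
      Finsupp.single σ.1 (p * MvPolynomial.monomial (faceLabel label σ.1) 1) := by
  rw [dehomogenize, Finsupp.linearCombination_single, Finsupp.smul_single, smul_eq_mul]

theorem dehomogenize_apply {n : ℕ} (x : Chain k τ Δ n) (σ : Δ.FaceOfDim n) :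
    dehomogenize k Δ label n x σ.1 =
      x σ * MvPolynomial.monomial (faceLabel label σ.1) 1 := by
  classical
  induction x using Finsupp.induction_linear with
  | zero => simp
  | add x y hx hy => rw [map_add, Finsupp.add_apply, hx, hy, Finsupp.add_apply, add_mul]
  | single ρ p =>
    rw [dehomogenize_single, Finsupp.single_apply, Finsupp.single_apply]
    by_cases h : ρ = σ
    · subst h; simp
    · rw [if_neg h, if_neg fun h' => h (Subtype.ext h'), zero_mul]

theorem dehomogenize_injective (n : ℕ) : Function.Injective (dehomogenize k Δ label n) := by
  rw [injective_iff_map_eq_zero]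
  intro x hx
  ext1 σ
  have h := dehomogenize_apply (label := label) x σ
  rw [hx, Finsupp.zero_apply, eq_comm, mul_eq_zero] at h
  exact h.resolve_right (by simp)

/-- Since `e_σ` becomes a multiple of `M_σ`, only faces with `M_σ ∣ x^m` contribute in degree `m`,
and these have all their vertices in `W`. -/
theorem mapRange_coeff_dehomogenize_mem {n : ℕ} (x : Chain k τ Δ n) {m : τ →₀ ℕ}
    {W : Finset V} (hW : ∀ v, v ∈ W ↔ label v ≤ m) :
    Finsupp.mapRange.addMonoidHom (MvPolynomial.coeffAddMonoidHom m)
      (dehomogenize k Δ label n x) ∈ chains k (Δ.facesIn W) (n + 1) := by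
  classical
  induction x using Finsupp.induction_linear with
  | zero => simp
  | add x y hx hy => rw [map_add, map_add]; exact add_mem hx hy
  | single σ p =>
    rw [dehomogenize_single, Finsupp.mapRange.addMonoidHom_apply, Finsupp.mapRange_single,
      MvPolynomial.coeffAddMonoidHom_apply, MvPolynomial.coeff_mul_monomial']
    split_ifs with h
    · refine Finsupp.single_mem_supported k _ ⟨⟨fun v hv => ?_, Or.inr σ.2.1⟩, σ.2.2⟩
      exact (hW v).2 ((Finset.le_sup (f := label) hv).trans h)
    · rw [Finsupp.single_zero]
      exact zero_mem _

/-- Conversely, `M_σ ∣ x^m` for every face in `W`, so `x^m σ` is the image of `(x^m / M_σ) e_σ`. -/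
theorem mapRange_monomial_mem_range {n : ℕ} {m : τ →₀ ℕ} {W : Finset V}
    (hW : ∀ v, v ∈ W ↔ label v ≤ m) {y : Finset V →₀ k}
    (hy : y ∈ chains k (Δ.facesIn W) (n + 1)) :
    Finsupp.mapRange.addMonoidHom (MvPolynomial.monomial m : k →ₗ[k] _).toAddMonoidHom y ∈
      LinearMap.range (dehomogenize k Δ label n) := by
  rw [← y.sum_single, Finsupp.sum, map_sum]
  refine Submodule.sum_mem _ fun σ hσ => ?_
  obtain ⟨⟨hσW, hσ0⟩, hσn⟩ := (Finsupp.mem_supported k y).1 hy hσ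
  have hσΔ : σ ∈ Δ.faces := hσ0.resolve_left (by rintro rfl; simp at hσn)
  refine ⟨Finsupp.single ⟨σ, hσΔ, hσn⟩
    (MvPolynomial.monomial (m - faceLabel label σ) (y σ)), ?_⟩
  have hle : faceLabel label σ ≤ m := Finset.sup_le fun v hv => (hW v).1 (hσW hv)
  rw [dehomogenize_single, MvPolynomial.monomial_mul, mul_one, tsub_add_cancel_of_le hle,
    Finsupp.mapRange.addMonoidHom_apply, Finsupp.mapRange_single]
  rfl

theorem exists_sum_mapRange (w : Finset V →₀ MvPolynomial τ k) :
    ∃ M : Finset (τ →₀ ℕ), ∑ m ∈ M,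
      Finsupp.mapRange.addMonoidHom (MvPolynomial.monomial m : k →ₗ[k] _).toAddMonoidHom
        (Finsupp.mapRange.addMonoidHom (MvPolynomial.coeffAddMonoidHom m) w) = w := by
  classical
  refine ⟨w.support.biUnion fun σ => (w σ).support, ?_⟩
  ext1 σ
  simp only [Finsupp.finsetSum_apply, Finsupp.mapRange.addMonoidHom_apply,
    Finsupp.mapRange_apply]
  change ∑ m ∈ _, MvPolynomial.monomial m (MvPolynomial.coeff m (w σ)) = w σ
  by_cases hσ : σ ∈ w.support
  · conv_rhs => rw [← MvPolynomial.support_sum_monomial_coeff (w σ)]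
    refine (Finset.sum_subset (Finset.subset_biUnion_of_mem (fun σ => (w σ).support) hσ)
      fun m _ hm => ?_).symm
    rw [MvPolynomial.notMem_support_iff.1 hm, MvPolynomial.monomial_zero]
  · rw [Finsupp.notMem_support_iff.1 hσ]
    simp

variable [LinearOrder V]

/-- The vertices in `W` can be removed one by one, each being dominated by another vertex. -/
inductive Dismantlable (Δ : PreAbstractSimplicialComplex V) : Finset V → Prop
  | single (v : V) : Dismantlable Δ {v}
  | step {W : Finset V} {u v : V} (huv : u ≠ v) (hu : u ∈ W)
      (h : ∀ σ ⊆ W, σ ∈ Δ.faces → v ∈ σ → insert u σ ∈ Δ.faces)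
      (hW : Dismantlable Δ (W.erase v)) : Dismantlable Δ W

theorem Dismantlable.acyclic (R : Type*) [CommRing R] {Δ : PreAbstractSimplicialComplex V}
    (hΔ : ∀ v, {v} ∈ Δ.faces) {W : Finset V} (h : Δ.Dismantlable W) :
    Acyclic R (Δ.facesIn W) := by
  induction h with
  | single v =>
    refine acyclic_of_cone v fun σ hσ => ?_
    have : insert v σ = {v} := by
      rw [← LawfulSingleton.insert_empty_eq, ← Finset.insert_idem v ∅]
      obtain h | h := Finset.subset_singleton_iff.1 hσ.1 <;> simp [h]
    rw [this]
    exact ⟨subset_rfl, Or.inr (hΔ v)⟩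
  | @step W u v huv hu h _ ih =>
    refine acyclic_of_dominated (fun σ hσ τ hτ => facesIn_subset hσ hτ) huv ?_ ?_
    · intro σ hσ hv
      refine ⟨Finset.insert_subset hu hσ.1, Or.inr (h σ hσ.1 ?_ hv)⟩
      exact hσ.2.resolve_left (Finset.ne_empty_of_mem hv)
    · convert ih using 2
      ext σ
      simp only [facesIn, Set.mem_ofPred_eq, Finset.subset_erase]
      tauto

theorem bd_dehomogenize {n : ℕ} (x : Chain k τ Δ (n + 1)) :
    bd V _ (dehomogenize k Δ label (n + 1) x) =
      dehomogenize k Δ label n (Δ.boundary k label n x) := by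
  induction x using Finsupp.induction_linear with
  | zero => simp
  | add x y hx hy => simp only [map_add, hx, hy]
  | single σ p =>
    rw [dehomogenize_single, bd_single, boundary, Finsupp.linearCombination_single, map_smul,
      map_sum, Finset.smul_sum, ← Finset.sum_coe_sort]
    refine Finset.sum_congr rfl fun v _ => ?_
    rw [dehomogenize_single, Finsupp.smul_single, smul_eq_mul, mul_assoc,
      MvPolynomial.monomial_mul, one_mul]
    have hle : faceLabel label (σ.erase v).1 ≤ faceLabel label σ.1 :=
      Finset.sup_mono (Finset.erase_subset _ _)
    have : faceLabel label σ.1 - faceLabel label (σ.1.erase v.1) +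
        faceLabel label (σ.erase v).1 = faceLabel label σ.1 := tsub_add_cancel_of_le hle
    rw [this, mul_left_comm]
    rfl

theorem bd_dehomogenize_zero (x : Chain k τ Δ 0) :
    bd V _ (dehomogenize k Δ label 0 x) =
      Finsupp.single ∅ (Δ.augmentation k label x) := by
  induction x using Finsupp.induction_linear with
  | zero => simp
  | add x y hx hy => simp only [map_add, hx, hy, Finsupp.single_add]
  | single σ p =>
    rw [dehomogenize_single, bd_single, augmentation, Finsupp.linearCombination_single,
      smul_eq_mul]
    obtain ⟨v, hv⟩ := Finset.card_eq_one.1 σ.2.2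
    rw [hv, Finset.sum_singleton]
    simp [sgn, Finset.filter_singleton]

/-- A multigraded criterion for the exactness of the homogenized chain complex. -/
theorem exists_boundary_eq [Finite V] (hΔ : ∀ v, {v} ∈ Δ.faces)
    (h : ∀ (m : τ →₀ ℕ) (W : Finset V), W.Nonempty → (∀ v, v ∈ W ↔ label v ≤ m) →
      Δ.Dismantlable W) {n : ℕ} (x : Chain k τ Δ n)
    (hx : bd V _ (dehomogenize k Δ label n x) = 0) : ∃ y, Δ.boundary k label n y = x := by
  classical
  cases nonempty_fintype V
  -- Each multigraded component of the cycle is an ordinary cycle over `k` on the faces in `W`. It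
  -- is bounded there and multiplied back by `x^m`.
  have key : ∀ m : τ →₀ ℕ, Finsupp.mapRange.addMonoidHom
      (MvPolynomial.monomial m : k →ₗ[k] _).toAddMonoidHom
      (Finsupp.mapRange.addMonoidHom (MvPolynomial.coeffAddMonoidHom m)
        (dehomogenize k Δ label n x)) ∈
      LinearMap.range (bd V (MvPolynomial τ k) ∘ₗ dehomogenize k Δ label (n + 1)) := by
    intro m
    let W : Finset V := Finset.univ.filter (label · ≤ m)
    have hW : ∀ v, v ∈ W ↔ label v ≤ m := fun v => by simp [W]
    have hz := mapRange_coeff_dehomogenize_mem x hW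
    have hz0 : bd V k (Finsupp.mapRange.addMonoidHom (MvPolynomial.coeffAddMonoidHom m)
        (dehomogenize k Δ label n x)) = 0 := by rw [bd_mapRange, hx, map_zero]
    have hA : Acyclic k (Δ.facesIn W) := by
      obtain hW0 | hW0 := W.eq_empty_or_nonempty
      · intro n z hz _
        have : z = 0 := by
          ext1 σ
          by_contra hσ
          obtain ⟨⟨hσW, -⟩, hn⟩ :=
            (Finsupp.mem_supported k z).1 hz (Finsupp.mem_support_iff.2 hσ)
          rw [hW0, Finset.subset_empty] at hσW
          simp [hσW] at hn
        exact ⟨0, zero_mem _, by rw [this, map_zero]⟩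
      · exact (h m W hW0 hW).acyclic k hΔ
    obtain ⟨y, hy, hyz⟩ := hA n _ hz hz0
    obtain ⟨w, hw⟩ := mapRange_monomial_mem_range hW hy
    exact ⟨w, by rw [LinearMap.comp_apply, hw, bd_mapRange, hyz]⟩
  obtain ⟨M, hM⟩ := exists_sum_mapRange (dehomogenize k Δ label n x)
  obtain ⟨y, hy⟩ := Submodule.sum_mem _ fun m (_ : m ∈ M) => key m
  rw [hM, LinearMap.comp_apply, bd_dehomogenize] at hy
  exact ⟨y, dehomogenize_injective n hy⟩

end PreAbstractSimplicialComplex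
end

/-! ### From dismantlable strands to minimal resolutions. -/

noncomputable section
universe u

open LatticePoint SimplicialChain

namespace PreAbstractSimplicialComplex

variable {k : Type u} [Field k] {τ : Type} {V : Type} [LinearOrder V]
  {Δ : PreAbstractSimplicialComplex V} {label : V → τ →₀ ℕ}

/-- A labelled complex all of whose multigraded pieces are dismantlable supports a resolution. -/
theorem isIdealResolution_of_dismantlable [Finite V] (hΔ : ∀ v, {v} ∈ Δ.faces)
    (h : ∀ (m : τ →₀ ℕ) (W : Finset V), W.Nonempty → (∀ v, v ∈ W ↔ label v ≤ m) →
      Δ.Dismantlable W) :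
    IsIdealResolution (labelIdeal k label Set.univ) (Chain k τ Δ) (Δ.boundary k label)
      (Δ.augmentation k label) where
  range_aug := by
    rw [augmentation, Finsupp.range_linearCombination, labelIdeal, Ideal.span, Set.image_univ,
      ← Set.range_comp]
    congr 1
    ext p
    constructor
    · rintro ⟨σ, rfl⟩
      obtain ⟨v, hv⟩ := Finset.card_eq_one.1 σ.2.2
      exact ⟨v, by simp [hv, faceLabel]⟩
    · rintro ⟨v, rfl⟩
      exact ⟨⟨{v}, hΔ v, rfl⟩, by simp [faceLabel]⟩
  exact_aug := by
    intro x
    constructor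
    · intro hx
      exact exists_boundary_eq hΔ h x (by rw [bd_dehomogenize_zero, hx, Finsupp.single_zero])
    · rintro ⟨y, rfl⟩
      have := bd_bd (dehomogenize k Δ label 1 y)
      rwa [bd_dehomogenize, bd_dehomogenize_zero, Finsupp.single_eq_zero] at this
  exact_succ := by
    intro n x
    constructor
    · intro hx
      exact exists_boundary_eq hΔ h x (by rw [bd_dehomogenize, hx, map_zero])
    · rintro ⟨y, rfl⟩
      have := bd_bd (dehomogenize k Δ label (n + 2) y)
      rw [bd_dehomogenize, bd_dehomogenize] at this
      exact dehomogenize_injective n (this.trans (map_zero _).symm)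

/-- By `hlab`, deleting `v` strictly lowers the exponent of `x_A` in the least common multiple, so
`M_σ / M_(σ \ {v})` is not constant. -/
theorem boundary_mem_smul_top
    (hlab : ∀ σ ∈ Δ.faces, ∀ v ∈ σ, 1 < σ.card → ∃ A, ∀ w ∈ σ, w ≠ v → label w A < label v A)
    (n : ℕ) (x : Chain k τ Δ (n + 1)) : Δ.boundary k label n x ∈
      (RingHom.ker (MvPolynomial.constantCoeff (σ := τ) (R := k))) •
        (⊤ : Submodule (MvPolynomial τ k) (Chain k τ Δ n)) := by
  classical
  rw [boundary, Finsupp.linearCombination_apply]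
  refine Submodule.sum_mem _ fun σ _ => Submodule.smul_mem _ _ (Submodule.sum_mem _ fun v _ => ?_)
  have : ∀ (ρ : Δ.FaceOfDim n) (p : MvPolynomial τ k),
      Finsupp.single ρ p = p • Finsupp.single ρ 1 := fun ρ p => by simp
  rw [this]
  refine Submodule.smul_mem_smul (Ideal.mul_mem_left _ _ ?_) Submodule.mem_top
  rw [RingHom.mem_ker, MvPolynomial.constantCoeff_monomial, if_neg]
  intro h0
  have hcard : 1 < σ.1.card := by rw [σ.2.2]; omega
  obtain ⟨A, hA⟩ := hlab σ.1 σ.2.1 v.1 v.2 hcard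
  obtain ⟨w, hw, hwv⟩ := Finset.exists_mem_ne hcard v.1
  have h1 := (Finset.le_sup (f := label) v.2).trans (tsub_eq_zero_iff_le.1 h0) A
  have h2 : faceLabel label (σ.1.erase v.1) A = (σ.1.erase v.1).sup fun c => label c A :=
    Finset.apply_sup_eq_sup_comp (fun x : τ →₀ ℕ => x A) (fun _ _ => rfl) rfl
  rw [h2] at h1
  refine absurd h1 (not_le.2 ?_)
  rw [Finset.sup_lt_iff (Nat.zero_lt_of_lt (hA w hw hwv))]
  exact fun c hc => hA c (Finset.mem_of_mem_erase hc) (Finset.ne_of_mem_erase hc)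

theorem ker_constantCoeff_ne_top :
    RingHom.ker (MvPolynomial.constantCoeff (σ := τ) (R := k)) ≠ ⊤ := RingHom.ker_ne_top _

theorem smul_top_ne_top {S ι : Type*} [CommRing S] [Nonempty ι] {𝔪 : Ideal S} (hm : 𝔪 ≠ ⊤) :
    𝔪 • (⊤ : Submodule S (ι →₀ S)) ≠ ⊤ := by
  intro h
  obtain ⟨i⟩ := ‹Nonempty ι›
  have h1 : (Finsupp.single i 1 : ι →₀ S) ∈ 𝔪 • (⊤ : Submodule S (ι →₀ S)) := by
    rw [h]; exact Submodule.mem_top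
  have h2 := Submodule.smul_top_le_comap_smul_top 𝔪 (Finsupp.lapply (R := S) i) h1
  refine hm ((Ideal.eq_top_iff_one _).2 ?_)
  simpa using h2

theorem exists_dimension_eq {V : Type*} {Δ : PreAbstractSimplicialComplex V} [Finite V]
    (hΔ : Δ.faces.Nonempty) :
    ∃ n : ℕ, Δ.dimension = n ∧ (∃ σ ∈ Δ.faces, σ.card = n + 1) ∧
      ∀ σ ∈ Δ.faces, σ.card ≤ n + 1 := by
  obtain ⟨σ, hσ, hmax⟩ := Set.exists_max_image Δ.faces Finset.card (Set.toFinite _) hΔ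
  have hpos : 0 < σ.card := Finset.card_pos.2 (Δ.isRelLowerSet_faces hσ).1
  refine ⟨σ.card - 1, le_antisymm (iSup₂_le fun ρ hρ => ?_)
    (le_dimension hσ (by omega)), ⟨σ, hσ, by omega⟩, fun ρ hρ => ?_⟩
  · exact_mod_cast Nat.sub_le_sub_right (hmax ρ hρ) 1
  · have := hmax ρ hρ
    omega

/-- A minimal resolution supported on `Δ` computes the projective dimension. -/
theorem projectiveDimension_eq_dimension [Finite V] (hΔ : Δ.faces.Nonempty)
    {I : Ideal (MvPolynomial τ k)}
    (hlab : ∀ σ ∈ Δ.faces, ∀ v ∈ σ, 1 < σ.card → ∃ A, ∀ w ∈ σ, w ≠ v → label w A < label v A)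
    (h : IsIdealResolution I (Chain k τ Δ) (Δ.boundary k label) (Δ.augmentation k label)) :
    CategoryTheory.projectiveDimension (ModuleCat.of (MvPolynomial τ k) I) = Δ.dimension := by
  obtain ⟨n, hn, ⟨σ, hσ, hσn⟩, hmax⟩ := exists_dimension_eq hΔ
  have : IsEmpty (Δ.FaceOfDim (n + 1)) := ⟨fun ρ => by
    have := hmax ρ.1 ρ.2.1
    have := ρ.2.2
    omega⟩
  have hsub : Subsingleton (Chain k τ Δ (n + 1)) := inferInstance
  have : Nonempty (Δ.FaceOfDim n) := ⟨⟨σ, hσ, hσn⟩⟩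
  rw [hn]
  apply le_antisymm
  · rw [CategoryTheory.projectiveDimension_le_iff]
    exact (h.isResolution.finiteFreeDimLT hsub).hasProjectiveDimensionLT
  · rw [CategoryTheory.projectiveDimension_ge_iff]
    exact h.isResolution.not_hasProjectiveDimensionLT _ (boundary_mem_smul_top hlab)
      (smul_top_ne_top ker_constantCoeff_ne_top) hsub

theorem supportsMinimalFreeResolution [Finite V] {I : Ideal (MvPolynomial τ k)}
    (hlab : ∀ σ ∈ Δ.faces, ∀ v ∈ σ, 1 < σ.card → ∃ A, ∀ w ∈ σ, w ≠ v → label w A < label v A)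
    (h : IsIdealResolution I (Chain k τ Δ) (Δ.boundary k label) (Δ.augmentation k label)) :
    Δ.SupportsMinimalFreeResolution label I :=
  h.isMinimalIdealResolution ker_constantCoeff_ne_top (boundary_mem_smul_top hlab)

theorem Dismantlable.of_erase [inst : DecidableEq V] {W : Finset V} {u v : V} (huv : u ≠ v)
    (hu : u ∈ W) (h : ∀ σ ⊆ W, σ ∈ Δ.faces → v ∈ σ → insert u σ ∈ Δ.faces)
    (hW : Δ.Dismantlable (W.erase v)) : Δ.Dismantlable W := by
  obtain rfl : inst = LinearOrder.toDecidableEq := Subsingleton.elim _ _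
  exact .step huv hu h hW

theorem dismantlable_of_simplex {W : Finset V} (hW : W.Nonempty)
    (h : ∀ σ ⊆ W, σ.Nonempty → σ ∈ Δ.faces) : Δ.Dismantlable W := by
  induction hW using Finset.Nonempty.cons_induction with
  | singleton v => exact .single v
  | cons v W hv hne ih =>
    rw [Finset.cons_eq_insert] at h ⊢
    obtain ⟨u, hu⟩ := hne
    refine .step (u := u) (v := v) (fun huv => hv (huv ▸ hu)) (Finset.mem_insert_of_mem hu) ?_ ?_
    · intro σ hσ _ _
      exact h _ (Finset.insert_subset (Finset.mem_insert_of_mem hu) hσ)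
        (Finset.insert_nonempty _ _)
    · rw [Finset.erase_insert hv]
      exact ih fun σ hσ => h σ (hσ.trans (Finset.subset_insert _ _))

end PreAbstractSimplicialComplex

open PreAbstractSimplicialComplex

/-! ### The small cases -/

theorem singleton_mem_LComplex {r q : ℕ} (hq : 1 ≤ q) (a : LatticePoint r q) :
    {a} ∈ (LComplex r q).faces := by
  refine ⟨Finset.singleton_nonempty a, ?_⟩
  simp only [Finset.coe_singleton, Set.singleton_subset_iff]
  by_cases h : ∃ i, (r + 1) / 2 < ofLex a.1 i
  · obtain ⟨i, hi⟩ := h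
    by_cases h' : ofLex a.1 i ≤ r - 1
    · refine ⟨i, Or.inl ⟨h'.trans (le_max_left _ _), fun j hj => ?_⟩⟩
      have := a.coord_add_le hj
      omega
    · exact ⟨i, Or.inr (not_le.1 h').le⟩
  · push Not at h
    exact ⟨⟨0, hq⟩, Or.inl (core_subset_firstLayer _ h)⟩

theorem exists_label_lt {r q : ℕ} {σ : Finset (LatticePoint r q)} {a : LatticePoint r q}
    (hσ : 1 < σ.card) {A : Finset (Fin q)}
    (h : ∀ b ∈ σ, b ≠ a → ∑ i ∈ A, ofLex b.1 i < ∑ i ∈ A, ofLex a.1 i) :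
    ∃ A, ∀ b ∈ σ, b ≠ a → extremalLabel r q b A < extremalLabel r q a A := by
  obtain ⟨b, hb, hba⟩ := Finset.exists_mem_ne hσ a
  have hA : A.Nonempty := by
    rw [Finset.nonempty_iff_ne_empty]
    rintro rfl
    exact absurd (h b hb hba) (lt_irrefl _)
  refine ⟨⟨A, hA⟩, fun c hc hca => ?_⟩
  rw [extremalLabel_apply, extremalLabel_apply]
  exact h c hc hca

theorem LatticePoint.eq_of_two_coords {r q : ℕ} {a b : LatticePoint r q} {i j : Fin q}
    (hij : i ≠ j) (hi : ofLex a.1 i = ofLex b.1 i) (hj : ofLex a.1 j = ofLex b.1 j)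
    (h : r ≤ ofLex a.1 i + ofLex a.1 j) : a = b := by
  refine ext_coord fun l => ?_
  by_cases hli : l = i
  · rw [hli, hi]
  by_cases hlj : l = j
  · rw [hlj, hj]
  have key : ∀ c : LatticePoint r q, ofLex c.1 l + (ofLex c.1 i + ofLex c.1 j) ≤ r := by
    intro c
    have := c.sum_le {l, i, j}
    rwa [Finset.sum_insert (by simp [hli, hlj]), Finset.sum_pair hij] at this
  have h1 := key a
  have h2 := key b
  omega

theorem corner_label_lt {r q : ℕ} {i : Fin q} {b : LatticePoint r q} (hb : b ≠ corner r i) :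
    ∑ l ∈ {i}, ofLex b.1 l < ∑ l ∈ {i}, ofLex (corner r i).1 l := by
  rw [Finset.sum_singleton, Finset.sum_singleton, corner_coord, if_pos rfl]
  by_contra h
  exact hb (eq_corner (not_lt.1 h))

/-- For `r = 3, 4` the complex `𝕃^r_2` is a path. -/
theorem mem_LComplex_two_iff {r : ℕ} (hr : r = 3 ∨ r = 4) {σ : Finset (LatticePoint r 2)} :
    σ ∈ (LComplex r 2).faces ↔
      σ.Nonempty ∧ ∃ t, ∀ a ∈ σ, ofLex a.1 0 = t ∨ ofLex a.1 0 = t + 1 := by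
  have hsum : ∀ a : LatticePoint r 2, ofLex a.1 0 + ofLex a.1 1 = r := fun a => by
    have := a.2
    rwa [Fin.sum_univ_two] at this
  have h01 : ∀ j : Fin 2, j ≠ 0 → j = 1 := by decide
  have h10 : ∀ j : Fin 2, j ≠ 1 → j = 0 := by decide
  have hF0 : ∀ a : LatticePoint r 2, a ∈ firstLayer r 2 0 ↔
      ofLex a.1 0 ≤ max (r - 1) ((r + 1) / 2) ∧ ofLex a.1 1 ≤ (r + 1) / 2 := fun a =>
    and_congr_right fun _ => ⟨fun h => h 1 (by decide), fun h j hj => h01 j hj ▸ h⟩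
  have hF1 : ∀ a : LatticePoint r 2, a ∈ firstLayer r 2 1 ↔
      ofLex a.1 1 ≤ max (r - 1) ((r + 1) / 2) ∧ ofLex a.1 0 ≤ (r + 1) / 2 := fun a =>
    and_congr_right fun _ => ⟨fun h => h 0 (by decide), fun h j hj => h10 j hj ▸ h⟩
  have hG : ∀ (i : Fin 2) (a : LatticePoint r 2), a ∈ secondLayer r 2 i ↔
      r - 1 ≤ ofLex a.1 i := fun _ _ => Iff.rfl
  refine and_congr_right fun ⟨a₀, ha₀⟩ => ?_
  simp only [Set.subset_def, Finset.mem_coe, Fin.exists_fin_two, hF0, hF1, hG]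
  constructor
  -- Here `s = 2`, and `F_0`, `G_0`, `F_1`, `G_1` are the edges with `t = r - 2`, `r - 1`, `1`, `0`.
  -- For `r = 3, 4` these are all the edges of the path.
  · rintro ((h | h) | (h | h))
    · refine ⟨r - 2, fun a ha => ?_⟩
      have := hsum a; have := h a ha; omega
    · refine ⟨r - 1, fun a ha => ?_⟩
      have := hsum a; have := h a ha; omega
    · refine ⟨1, fun a ha => ?_⟩
      have := hsum a; have := h a ha; omega
    · refine ⟨0, fun a ha => ?_⟩
      have := hsum a; have := h a ha; omega
  · rintro ⟨t, ht⟩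
    by_cases h1 : r - 1 ≤ t
    · exact Or.inl (Or.inr fun a ha => by have := ht a ha; omega)
    by_cases h2 : t = r - 2
    · exact Or.inl (Or.inl fun a ha => by have := ht a ha; have := hsum a; omega)
    by_cases h3 : t = 0
    · exact Or.inr (Or.inr fun a ha => by have := ht a ha; have := hsum a; omega)
    · exact Or.inr (Or.inl fun a ha => by have := ht a ha; have := hsum a; omega)

/-- In these cases `G_0` contains every vertex, so the complex is a simplex. -/
theorem mem_LComplex_of_nonempty {r q : ℕ} (h : r = 1 ∨ q = 1) (hq : 1 ≤ q)
    {σ : Finset (LatticePoint r q)} (hσ : σ.Nonempty) : σ ∈ (LComplex r q).faces := by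
  refine ⟨hσ, ⟨0, hq⟩, Or.inr fun a _ => ?_⟩
  change r - 1 ≤ ofLex a.1 _
  obtain rfl | rfl := h
  · exact Nat.zero_le _
  · have : ofLex a.1 0 = r := by simpa only [Fin.sum_univ_one] using a.2
    exact (Nat.sub_le r 1).trans_eq this.symm

/-- The distinguishing set `A` is `{i}` for a corner `r e_i`. For `r = 2` it is `{i, j}` for `e_i +
e_j` in a face of the first layer, and `{j}` for `e_l + e_j` in `G_l`. On an edge of the path it is
the coordinate in which the vertex is the larger one. For `r = 1` or `q = 1` every vertex is a
corner. -/
theorem LComplex_exists_label_lt {r q : ℕ} (hr : 1 ≤ r)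
    (h : (r = 1 ∨ q = 1) ∨ r = 2 ∨ (q = 2 ∧ (r = 3 ∨ r = 4))) :
    ∀ σ ∈ (LComplex r q).faces, ∀ a ∈ σ, 1 < σ.card →
      ∃ A, ∀ b ∈ σ, b ≠ a → extremalLabel r q b A < extremalLabel r q a A := by
  intro σ hσ a ha hcard
  by_cases hc : ∃ i, a = corner r i
  · obtain ⟨i, rfl⟩ := hc
    exact exists_label_lt hcard fun b _ hb => corner_label_lt hb
  have hlt : ∀ i, ofLex a.1 i < r := fun i => by
    by_contra hi
    exact hc ⟨i, eq_corner (not_lt.1 hi)⟩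
  obtain ⟨i, hi⟩ : ∃ i, 1 ≤ ofLex a.1 i := by
    by_contra! h0
    have := a.2
    rw [Finset.sum_eq_zero fun i _ => Nat.lt_one_iff.1 (h0 i)] at this
    omega
  obtain (rfl | rfl) | rfl | ⟨rfl, hr⟩ := h
  · have := hlt i
    omega
  · have h1 := hlt 0
    have : ofLex a.1 0 = r := by simpa only [Fin.sum_univ_one] using a.2
    omega
  · obtain ⟨-, l, hl | hl⟩ := hσ
    · have hle : ∀ b ∈ σ, ∀ j, ofLex b.1 j ≤ 1 := fun b hb j => by
        obtain rfl | hj := eq_or_ne j l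
        exacts [(hl hb).1, (hl hb).2 j hj]
      obtain ⟨j, hij, hj⟩ : ∃ j, i ≠ j ∧ 1 ≤ ofLex a.1 j := by
        by_contra! h0
        have h1 := Finset.sum_eq_single_of_mem (f := ofLex a.1) i (Finset.mem_univ _)
          fun j _ hj => Nat.lt_one_iff.1 (h0 j hj.symm)
        have h2 := hlt i
        rw [a.2] at h1
        omega
      refine exists_label_lt (A := {i, j}) hcard fun b hb hba => ?_
      rw [Finset.sum_pair hij, Finset.sum_pair hij]
      have h1 := hle b hb i
      have h2 := hle b hb j
      by_contra hlt'
      exact hba (eq_of_two_coords hij (by have := hle a ha i; omega)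
        (by have := hle a ha j; omega) (by omega))
    · have hle : ∀ b ∈ σ, 1 ≤ ofLex b.1 l := fun b hb => hl hb
      have hal := hle a ha
      obtain ⟨j, hlj, hj⟩ : ∃ j, l ≠ j ∧ 1 ≤ ofLex a.1 j := by
        by_contra! h0
        have h1 := Finset.sum_eq_single_of_mem (f := ofLex a.1) l (Finset.mem_univ _)
          fun j _ hj => Nat.lt_one_iff.1 (h0 j hj.symm)
        have h2 := hlt l
        rw [a.2] at h1
        omega
      refine exists_label_lt (A := {j}) hcard fun b hb hba => ?_
      rw [Finset.sum_singleton, Finset.sum_singleton]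
      have h1 := hle b hb
      have h2 := a.coord_add_le hlj
      have h3 := b.coord_add_le hlj
      by_contra hlt'
      exact hba (eq_of_two_coords hlj (by omega) (by omega) (by omega))
  · obtain ⟨-, t, ht⟩ := (mem_LComplex_two_iff hr).1 hσ
    have hsum : ∀ a : LatticePoint r 2, ofLex a.1 0 + ofLex a.1 1 = r := fun a => by
      have := a.2
      rwa [Fin.sum_univ_two] at this
    have hne : ∀ b, b ≠ a → ofLex b.1 0 ≠ ofLex a.1 0 := fun b hb h =>
      hb (eq_of_coord_zero_eq h)
    obtain hat | hat := ht a ha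
    · refine exists_label_lt (A := {1}) hcard fun b hb hba => ?_
      rw [Finset.sum_singleton, Finset.sum_singleton]
      have := hne b hba; have := ht b hb; have := hsum a; have := hsum b
      omega
    · refine exists_label_lt (A := {0}) hcard fun b hb hba => ?_
      rw [Finset.sum_singleton, Finset.sum_singleton]
      have := hne b hba; have := ht b hb
      omega

/-- A convex set of vertices spans a subpath. Its last vertex is a leaf dominated by its neighbour,
and removing it preserves convexity. -/
theorem dismantlable_of_convex {r : ℕ} (hr : r = 3 ∨ r = 4) {W : Finset (LatticePoint r 2)}
    (hW : W.Nonempty) (hc : ∀ a ∈ W, ∀ b ∈ W, ∀ c : LatticePoint r 2, ofLex a.1 0 ≤ ofLex c.1 0 →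
      ofLex c.1 0 ≤ ofLex b.1 0 → c ∈ W) : (LComplex r 2).Dismantlable W := by
  induction W using Finset.strongInduction with
  | H W ih =>
    obtain ⟨v, hv, hmax⟩ := W.exists_max_image (fun a => ofLex a.1 0) hW
    by_cases hWv : W = {v}
    · rw [hWv]
      exact .single v
    obtain ⟨w, hw, hwv⟩ : ∃ w ∈ W, w ≠ v := by
      by_contra! h
      exact hWv (Finset.eq_singleton_iff_unique_mem.2 ⟨hv, h⟩)
    have hlt : ∀ b ∈ W, b ≠ v → ofLex b.1 0 < ofLex v.1 0 := fun b hb hbv =>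
      lt_of_le_of_ne (hmax b hb) fun h => hbv (eq_of_coord_zero_eq h)
    have hwlt := hlt w hw hwv
    obtain ⟨u, hu, -⟩ := exists_coord_eq (r := r) (t := ofLex v.1 0 - 1)
      ((Nat.sub_le _ _).trans (v.coord_le 0))
    have huW : u ∈ W := hc w hw v hv u (by omega) (by omega)
    have huv : u ≠ v := by
      rintro rfl
      omega
    refine .of_erase huv huW ?_ (ih _ (Finset.erase_ssubset hv)
      ⟨u, Finset.mem_erase.2 ⟨huv, huW⟩⟩ ?_)
    · intro σ hσW hσ hvσ
      rw [mem_LComplex_two_iff hr] at hσ ⊢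
      obtain ⟨-, t, ht⟩ := hσ
      refine ⟨Finset.insert_nonempty _ _, ofLex v.1 0 - 1, fun b hb => ?_⟩
      obtain rfl | hb := Finset.mem_insert.1 hb
      · exact Or.inl hu
      · have h1 : ofLex b.1 0 ≤ ofLex v.1 0 := hmax b (hσW hb)
        have h2 := ht b hb
        have h3 := ht v hvσ
        omega
    · intro a ha b hb c hac hcb
      refine Finset.mem_erase.2 ⟨?_, hc a (Finset.mem_of_mem_erase ha) b
        (Finset.mem_of_mem_erase hb) c hac hcb⟩
      rintro rfl
      have := hlt b (Finset.mem_of_mem_erase hb) (Finset.ne_of_mem_erase hb)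
      omega

/-- The corner `2 e_i` lies in no facet but `G_i`, so any `u ∈ W` with `u_i = 1` dominates it. Such
a `u` is not a corner and survives the removal of other corners. Without corners all coordinates are
at most `1 = s`, and `W` spans a simplex. -/
theorem dismantlable_square {q : ℕ} (hq : 1 ≤ q) {W : Finset (LatticePoint 2 q)}
    (hW : W.Nonempty) (hc : ∀ i, corner 2 i ∈ W → W = {corner 2 i} ∨
      ∃ u ∈ W, ofLex u.1 i = 1) : (LComplex 2 q).Dismantlable W := by
  induction W using Finset.strongInduction with
  | H W ih =>
    by_cases h : ∃ i, corner 2 i ∈ W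
    · obtain ⟨i, hi⟩ := h
      have hii : ofLex (corner 2 i).1 i = 2 := by rw [corner_coord, if_pos rfl]
      obtain hs | ⟨u, hu, hui⟩ := hc i hi
      · rw [hs]
        exact .single _
      have huv : u ≠ corner 2 i := by
        rintro rfl
        omega
      refine .of_erase huv hu ?_ (ih _ (Finset.erase_ssubset hi)
        ⟨u, Finset.mem_erase.2 ⟨huv, hu⟩⟩ ?_)
      · rintro σ - ⟨-, l, hl | hl⟩ hσ
        · have h1 : ofLex (corner 2 i).1 i ≤ 1 := by
            obtain rfl | hj := eq_or_ne i l
            exacts [(hl hσ).1, (hl hσ).2 i hj]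
          omega
        · have h1 : 1 ≤ ofLex (corner 2 i).1 l := hl hσ
          rw [corner_coord] at h1
          split_ifs at h1 with hli
          · subst hli
            refine ⟨Finset.insert_nonempty _ _, l, Or.inr ?_⟩
            rw [Finset.coe_insert, Set.insert_subset_iff]
            exact ⟨hui.ge, hl⟩
          · omega
      · intro l hl
        obtain hs | ⟨w, hw, hwl⟩ := hc l (Finset.mem_of_mem_erase hl)
        · rw [hs, Finset.mem_singleton] at hi
          exact absurd hi.symm (Finset.ne_of_mem_erase hl)
        · refine Or.inr ⟨w, Finset.mem_erase.2 ⟨?_, hw⟩, hwl⟩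
          rintro rfl
          rw [corner_coord] at hwl
          split_ifs at hwl
          omega
    · push Not at h
      refine dismantlable_of_simplex hW fun σ hσW hσ => ⟨hσ, ⟨0, hq⟩, Or.inl fun a ha => ?_⟩
      refine core_subset_firstLayer _ fun j => ?_
      have h1 : ¬ 2 ≤ ofLex a.1 j := fun h2 => h j (eq_corner h2 ▸ hσW ha)
      omega

theorem LComplex_dismantlable {r q : ℕ} (hq : 1 ≤ q)
    (h : (r = 1 ∨ q = 1) ∨ r = 2 ∨ (q = 2 ∧ (r = 3 ∨ r = 4))) (m : ExtremalVar q →₀ ℕ)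
    (W : Finset (LatticePoint r q)) (hW : W.Nonempty)
    (hm : ∀ a, a ∈ W ↔ extremalLabel r q a ≤ m) : (LComplex r q).Dismantlable W := by
  obtain h | rfl | ⟨rfl, hr⟩ := h
  · exact dismantlable_of_simplex hW fun σ _ hσ => mem_LComplex_of_nonempty h hq hσ
  · refine dismantlable_square hq hW fun i hi => or_iff_not_imp_left.2 fun hne => ?_
    obtain ⟨w, hw, hwi⟩ : ∃ w ∈ W, w ≠ corner 2 i := by
      by_contra! h
      exact hne (Finset.eq_singleton_iff_unique_mem.2 ⟨hi, h⟩)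
    -- `W` contains every vertex whose label divides a least common multiple of labels from `W`,
    -- hence a neighbour of the corner as soon as it contains another vertex.
    obtain ⟨j, hij, h1, hle⟩ := exists_move_corner_le (by omega) hwi
    refine ⟨_, (hm _).2 (hle.trans (sup_le ((hm _).1 hw) ((hm _).1 hi))), ?_⟩
    rw [move_coord, if_pos rfl, corner_coord, if_pos rfl]
  · exact dismantlable_of_convex hr hW fun a ha b hb c hac hcb =>
      (hm c).2 ((label_le_sup_of_between hac hcb).trans (sup_le ((hm a).1 ha) ((hm b).1 hb)))

theorem isIdealResolution_LComplex (k : Type u) [Field k] {r q : ℕ} (hq : 1 ≤ q)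
    (h : (r = 1 ∨ q = 1) ∨ r = 2 ∨ (q = 2 ∧ (r = 3 ∨ r = 4))) :
    IsIdealResolution (extremalIdeal k q ^ r)
      (Chain k (ExtremalVar q) (LComplex r q))
      ((LComplex r q).boundary k (extremalLabel r q))
      ((LComplex r q).augmentation k (extremalLabel r q)) := by
  rw [extremalIdeal_pow]
  exact isIdealResolution_of_dismantlable (singleton_mem_LComplex hq) (LComplex_dismantlable hq h)

end
-- The equivalence.
theorem proposition7p7 (k : Type*) [Field k] (r q : ℕ) (hr : 1 ≤ r) (hq : 1 ≤ q) :
    List.TFAE [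
      (LComplex r q).SupportsMinimalFreeResolution (extremalLabel r q) (extremalIdeal k q ^ r),
      CategoryTheory.projectiveDimension
          (ModuleCat.of (ExtremalRing k q) ↥(extremalIdeal k q ^ r)) =
        (LComplex r q).dimension,
      (q = 1 ∧ 1 ≤ r) ∨ (q = 2 ∧ 1 ≤ r ∧ r ≤ 4) ∨ (3 ≤ q ∧ 1 ≤ r ∧ r ≤ 2)] := by
  tfae_have 1 → 3 := by
    intro h1
    by_contra h3
    obtain ⟨n, hn, σ, hσ, hc⟩ := exists_face_of_not_small k hr hq h3
    exact PreAbstractSimplicialComplex.not_supportsMinimalFreeResolution hn hσ hc h1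
  tfae_have 2 → 3 := by
    intro h2
    by_contra h3
    obtain ⟨n, hn, σ, hσ, hc⟩ := exists_face_of_not_small k hr hq h3
    exact PreAbstractSimplicialComplex.projectiveDimension_ne_dimension hn hσ hc h2
  tfae_have 3 → 1 := fun h3 =>
    PreAbstractSimplicialComplex.supportsMinimalFreeResolution
      (LComplex_exists_label_lt hr (by omega))
      (isIdealResolution_LComplex k hq (by omega))
  tfae_have 3 → 2 := fun h3 =>
    PreAbstractSimplicialComplex.projectiveDimension_eq_dimension
      ⟨_, singleton_mem_LComplex hq (LatticePoint.corner r ⟨0, hq⟩)⟩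
      (LComplex_exists_label_lt hr (by omega)) (isIdealResolution_LComplex k hq (by omega))
  tfae_finish
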